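/- All graphs are finite and simple. A $k$-separator of a graph is a set of $k$ vertices whose deletion leaves a disconnected graph; a block is a connected graph without a 1-separator. For a subgraph $H$ of $G$, an $H$-bridge of $G$ is either an edge outside $H$ with both endvertices in $H$, or a component of $G-H$ together with all edges joining it to $H$ (and their endvertices); its vertices in $H$ are its attachments. Let $B$ be a plane block with at least one edge, let $C$ be the boundary of its outer face, and for vertices $x,y$ of $C$ let $xCy$ be the clockwise path from $x$ to $y$ in $C$. Let $s \in V(C)$, let $t \neq s$ be a vertex of $B$ (on $C$ or not), and let $\alpha$ be an edge of $C$, with endvertices $l,r$ in clockwise order. (For a block $B=B_i$ of a plane chain of blocks $K=B_1\cup\dots\cup B_l$ with $v_i$ the vertex common to $B_i$ and $B_{i+1}$ and with end vertices $v_0\in B_1$, $v_l\in B_l$, one takes $s=v_{i-1}$, $t=v_i$, $\alpha=\alpha_i$.) *Boundary points.* If $t\in C$, the boundary points of $B$ are $s,l,r,t$. If $t\notin C$, consider the 2-separators $\{w,w'\}\subseteq V(C)$ of $B$ such that the $\{w,w'\}$-bridge containing $wCw'$ contains $t$ and $wCw'$ is contained in one of the paths $sCl$, $\alpha$, $rCs$.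 If there is none, the boundary points are $s,l,r$; otherwise choose one for which $wCw'$ is shortest, and let the boundary points be $s,l,r$ and the attachments of the $wCw'$-bridge of $B$ that contains $t$ (the result holds for every such choice). *Boundary parts and maximality.* A boundary part is an inclusion-wise maximal path of $C$ without boundary points as inner vertices. For a boundary part $Z$, $\{c,d\}^*\subseteq Z$ means that $c,d\in Z$ and $cCd\subseteq Z$. A 2-separator $\{c,d\}^*$ is maximal if for some boundary part $Z$ we have $\{c,d\}^*\subseteq Z$ and there is no 2-separator $\{c',d'\}^*\subseteq Z$ of $B$ with $cCd\subsetneq c'Cd'$. Two 2-separators $\{c,d\}^*$ and $\{c',d'\}^*$ interlace if $\{c,d\}\cap\{c',d'\}=\emptyset$ and their vertices appear on $C$ in the order $c,c',d,d'$ or $c',c,d',d$. **Lemma.** Let $\{c,d\}^*,\{c',d'\}^*\subseteq Z$ be interlacing 2-separators of $B$ in a boundary part $Z$ such that $c'\in cCd$ and at least one of them is maximal. Then $s$ and $t$ are adjacent and the path $d'Cc$ is exactly the edge $st=\alpha$. **Corollary.** At most two maximal 2-separators of $B$ interlace with some maximal 2-separator of $B$. -/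

import Mathlib

namespace SimpleGraph

variable {V : Type*}

/-- `S` is a `k`-separator of `G`: it has `k` vertices and `G - S` is disconnected. -/
def IsSeparator (G : SimpleGraph V) (k : ℕ) (S : Set V) : Prop :=
  S.encard = k ∧ ¬ (G.induce Sᶜ).Preconnected

/-- A block: a connected graph without a 1-separator. -/
def IsBlock (G : SimpleGraph V) : Prop :=
  G.Connected ∧ ∀ S : Set V, ¬ G.IsSeparator 1 S

/-- The edgeless subgraph on a vertex set. -/
def vertexSubgraph (G : SimpleGraph V) (S : Set V) : G.Subgraph where
  verts := S
  Adj _ _ := False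
  adj_sub h := h.elim
  edge_vert h := h.elim
  symm := ⟨fun _ _ h => h⟩

/-- A component `K` of `G - H`, together with all edges (and their endvertices) that join
vertices of `K` with vertices of `H`. -/
def componentBridge (G : SimpleGraph V) (H : G.Subgraph)
    (K : (G.induce H.vertsᶜ).ConnectedComponent) : G.Subgraph where
  verts := {u | u ∈ Subtype.val '' K.supp ∨
    (u ∈ H.verts ∧ ∃ w ∈ Subtype.val '' K.supp, G.Adj u w)}
  Adj a b := G.Adj a b ∧ (a ∈ Subtype.val '' K.supp ∨ b ∈ Subtype.val '' K.supp)
  adj_sub h := h.1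
  edge_vert := by
    rintro a b ⟨hab, ha | ⟨b', hb', rfl⟩⟩
    · exact Or.inl ha
    · by_cases haH : a ∈ H.verts
      · exact Or.inr ⟨haH, _, ⟨b', hb', rfl⟩, hab⟩
      · refine Or.inl ⟨⟨a, haH⟩, ?_, rfl⟩
        have h1 : (G.induce H.vertsᶜ).Adj ⟨a, haH⟩ b' := hab
        rw [ConnectedComponent.mem_supp_iff] at hb' ⊢
        rw [← hb']
        exact ConnectedComponent.sound h1.reachable
  symm := ⟨fun _ _ h => ⟨h.1.symm, h.2.symm⟩⟩

/-- `L` is an `H`-bridge of `G`: a single edge outside `H` with both endvertices in `H`, or a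
component of `G - H` together with the edges joining it to `H`. -/
def IsSubgraphBridge (G : SimpleGraph V) (H L : G.Subgraph) : Prop :=
  (∃ (u w : V) (h : G.Adj u w), u ∈ H.verts ∧ w ∈ H.verts ∧ ¬ H.Adj u w ∧
    L = G.subgraphOfAdj h) ∨
  ∃ K : (G.induce H.vertsᶜ).ConnectedComponent, L = G.componentBridge H K

/-- A rotation system: a cyclic (clockwise) order of the darts leaving each vertex. -/
structure RotationSystem (G : SimpleGraph V) where
  rot : Equiv.Perm G.Dart
  rot_fst : ∀ d, (rot d).fst = d.fst
  rot_cyclic : ∀ d e : G.Dart, d.fst = e.fst → rot.SameCycle d e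

/-- Walking along a face that lies to the left: from a dart `u → w` to the dart that follows
`w → u` in the clockwise order around `w`. -/
def RotationSystem.next {G : SimpleGraph V} (R : G.RotationSystem) : Equiv.Perm G.Dart :=
  (Function.Involutive.toPerm Dart.symm Dart.symm_involutive).trans R.rot

/-- The faces of a rotation system: the orbits of darts under `next`. -/
def RotationSystem.Face {G : SimpleGraph V} (R : G.RotationSystem) : Type _ :=
  Quotient (Equiv.Perm.SameCycle.setoid R.next)

end SimpleGraph

/-- A plane embedding of a finite connected graph with at least one edge: a rotation system of
Euler characteristic 2, and a distinguished outer face. As faces lie to the left of their darts,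
the outer face traverses its boundary in clockwise direction. -/
structure PlaneEmbedding {V : Type*} [Finite V] (G : SimpleGraph V)
    extends G.RotationSystem where
  connected : G.Connected
  euler : Nat.card V + Nat.card toRotationSystem.Face = Nat.card G.edgeSet + 2
  outer : toRotationSystem.Face

namespace PlaneEmbedding

variable {V : Type*} [Finite V] {G : SimpleGraph V} (M : PlaneEmbedding G)

/-- The dart `d` is on the boundary of the outer face (traversed clockwise). -/
def IsOuter (d : G.Dart) : Prop :=
  (Quotient.mk (Equiv.Perm.SameCycle.setoid M.next) d : M.Face) = M.outer

/-- The vertices of the boundary `C` of the outer face. -/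
def outerVerts : Set V := {x | ∃ d : G.Dart, M.IsOuter d ∧ d.fst = x}

theorem next_fst (d : G.Dart) : (M.next d).fst = d.snd := by
  change (M.rot d.symm).fst = d.snd
  rw [M.rot_fst]; rfl

theorem iterate_succ_fst (d : G.Dart) (k : ℕ) :
    (M.next^[k + 1] d).fst = (M.next^[k] d).snd := by
  rw [Function.iterate_succ_apply', next_fst]

/-- For `x` and `y` on the boundary `C` of the outer face, the clockwise path `xCy`: start at
`x` and follow the outer face until `y` is reached for the first time. -/
def arc (x y : V) : G.Subgraph where
  verts := {z | ∃ (d : G.Dart) (k : ℕ), M.IsOuter d ∧ d.fst = x ∧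
    (M.next^[k] d).fst = z ∧ ∀ j < k, (M.next^[j] d).fst ≠ y}
  Adj z w := ∃ (d : G.Dart) (k : ℕ), M.IsOuter d ∧ d.fst = x ∧
    (M.next^[k] d).edge = s(z, w) ∧ ∀ j ≤ k, (M.next^[j] d).fst ≠ y
  adj_sub := by
    rintro z w ⟨d, k, -, -, he, -⟩
    rw [← SimpleGraph.mem_edgeSet, ← he]
    exact SimpleGraph.Dart.edge_mem _
  edge_vert := by
    rintro z w ⟨d, k, ho, hx, he, hj⟩
    have hz : z ∈ (M.next^[k] d).edge := by rw [he]; exact Sym2.mem_mk_left z w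
    rw [show (M.next^[k] d).edge = s((M.next^[k] d).fst, (M.next^[k] d).snd) from rfl,
      Sym2.mem_iff] at hz
    rcases hz with hz | hz
    · exact ⟨d, k, ho, hx, hz.symm, fun j h => hj j h.le⟩
    · exact ⟨d, k + 1, ho, hx, by rw [M.iterate_succ_fst, hz],
        fun j h => hj j (Nat.lt_succ_iff.mp h)⟩
  symm := ⟨by
    rintro z w ⟨d, k, ho, hx, he, hj⟩
    exact ⟨d, k, ho, hx, by rw [he, Sym2.eq_swap], hj⟩⟩

/-- The vertex `z` belongs to the `{c, d}`-bridge that contains the path `cCd`. -/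
def MemPlusBridge (c d z : V) : Prop :=
  ∃ L : G.Subgraph, G.IsSubgraphBridge (G.vertexSubgraph {c, d}) L ∧ M.arc c d ≤ L ∧ z ∈ L.verts

/-- For a boundary edge `a`, clockwise from `l` to `r`: `{w, w'}` is a 2-separator with both
vertices on `C` whose bridge containing `wCw'` contains `t`, and the path `wCw'` lies in one of
the paths `sCa = sCl`, `a`, `aCs = rCs`. -/
def SplitsOff (s t : V) (a : G.Dart) (w w' : V) : Prop :=
  G.IsSeparator 2 {w, w'} ∧ w ∈ M.outerVerts ∧ w' ∈ M.outerVerts ∧ M.MemPlusBridge w w' t ∧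
    (M.arc w w' ≤ M.arc s a.fst ∨ M.arc w w' ≤ G.subgraphOfAdj a.adj ∨
      M.arc w w' ≤ M.arc a.snd s)

/-- `{w, w'}` is as above, with `wCw'` of minimal length. -/
def MinSplitsOff (s t : V) (a : G.Dart) (w w' : V) : Prop :=
  M.SplitsOff s t a w w' ∧ ∀ u u', M.SplitsOff s t a u u' →
    (M.arc w w').edgeSet.ncard ≤ (M.arc u u').edgeSet.ncard

/-- `S` is the set of boundary points belonging to `s`, `t` and the boundary edge `a` with
endvertices `l = a.fst` and `r = a.snd`. If `t` is on `C`, these are `s, l, r, t`. If `t` is not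
on `C`, these are `s, l, r` and, if some 2-separator as above splits off `t`, the attachments of
the `wCw'`-bridge containing `t`, where `{w, w'}` is such a 2-separator with `wCw'` shortest. -/
def IsBoundaryPoints (s t : V) (a : G.Dart) (S : Set V) : Prop :=
  (t ∈ M.outerVerts ∧ S = {s, a.fst, a.snd, t}) ∨
  (t ∉ M.outerVerts ∧ (¬ ∃ w w', M.SplitsOff s t a w w') ∧ S = {s, a.fst, a.snd}) ∨
  (t ∉ M.outerVerts ∧ ∃ w w', M.MinSplitsOff s t a w w' ∧
    ∃ L : G.Subgraph, G.IsSubgraphBridge (M.arc w w') L ∧ t ∈ L.verts ∧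
      S = {s, a.fst, a.snd} ∪ (L.verts ∩ (M.arc w w').verts))

/-- A boundary part: an inclusion-wise maximal path of `C` without boundary points as inner
vertices. -/
def IsBoundaryPart (S : Set V) (Z : G.Subgraph) : Prop :=
  Maximal (fun P : G.Subgraph => ∃ x ∈ M.outerVerts, ∃ y ∈ M.outerVerts,
    P = M.arc x y ∧ ∀ z ∈ P.verts, z ≠ x → z ≠ y → z ∉ S) Z

/-- `{c, d}* ⊆ Z` is a 2-separator of `G`: the vertices `c, d` and the path `cCd` are in `Z`. -/
def IsSeparatorIn (Z : G.Subgraph) (c d : V) : Prop :=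
  G.IsSeparator 2 {c, d} ∧ c ∈ Z.verts ∧ d ∈ Z.verts ∧ M.arc c d ≤ Z

/-- The 2-separator `{c, d}*` is maximal with respect to some boundary part `Z`. -/
def IsMaximalSeparator (S : Set V) (c d : V) : Prop :=
  ∃ Z : G.Subgraph, M.IsBoundaryPart S Z ∧ M.IsSeparatorIn Z c d ∧
    ∀ c' d', M.IsSeparatorIn Z c' d' → ¬ M.arc c d < M.arc c' d'

/-- `{c, d}` and `{c', d'}` are disjoint and their vertices appear in the clockwise order
`c, c', d, d'` or `c', c, d', d` on `C`. -/
def Interlace (c d c' d' : V) : Prop :=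
  Disjoint ({c, d} : Set V) {c', d'} ∧
    ((c' ∈ (M.arc c d).verts ∧ d' ∈ (M.arc d c).verts) ∨
      (c ∈ (M.arc c' d').verts ∧ d ∈ (M.arc d' c').verts))

end PlaneEmbedding

/-! Write the interlacing pairs in the order c, c', d, d'. The path cCd' lies in Z and properly
contains both cCd and c'Cd', so by maximality of one of them {c,d'} is not a separator. Hence every
vertex v other than c, c', d, d' has a walk to c' avoiding c and d'. Its first visit to c' or d
shows that v is joined to c' off {c,d} or to d off {c',d'} (`joinedAvoiding_or_of_preconnected`).

An inner vertex v of d'Cc can satisfy neither alternative, because a 2-separator on the outer cycle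
separates the two sides of the cycle (`IsOuter.not_joinedAvoiding`). So d'Cc is one edge and Z is
the rest of C. Boundary points are not inner vertices of Z, so this edge is α and s is one of its
ends; t is the other end if it lies on C. If t is off C, the two alternatives say that one of the
given pairs splits off t. The chosen pair {w,w'} then contributes at least two attachments as
boundary points; these must be l and r, so {w,w'} = {l,r} = {c,d'}, which is not a separator
(`not_splitsOff`).

For the corollary, of two interlacing maximal pairs one starts at r and the other ends at l, both in
rCl; maximality allows at most one pair of each kind.

Planarity enters through Euler's formula alone: a dimension count over `ZMod 2` makes every closed
walk a boundary of faces (`exists_face_colouring`). This replaces the Jordan curve theorem and also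
shows that the outer face visits each vertex only once. -/

namespace SimpleGraph

/-! ### Mod 2 chains of a rotation system. -/

variable {V : Type*} {G : SimpleGraph V}

/-- The mod 2 coboundary of a function on vertices. -/
def endSum (f : V → ZMod 2) : Sym2 V → ZMod 2 :=
  Sym2.lift ⟨fun u v => f u + f v, fun _ _ => add_comm _ _⟩

@[simp] theorem endSum_mk (f : V → ZMod 2) (u v : V) : endSum f s(u, v) = f u + f v := rfl

theorem endSum_edge (f : V → ZMod 2) (d : G.Dart) : endSum f d.edge = f d.fst + f d.snd := rfl

/-- The pairing of a coboundary with an edge chain over `ZMod 2`. -/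
noncomputable def coboundaryPairing (G : SimpleGraph V) [Fintype G.edgeSet] :
    (V → ZMod 2) →ₗ[ZMod 2] Module.Dual (ZMod 2) (G.edgeSet → ZMod 2) where
  toFun f :=
    { toFun := fun x => ∑ e, x e * endSum f e.1
      map_add' := fun x y => by simp [add_mul, Finset.sum_add_distrib]
      map_smul' := fun c x => by simp [Finset.mul_sum, mul_assoc] }
  map_add' f g := by
    ext x
    simp only [LinearMap.coe_mk, AddHom.coe_mk,
      LinearMap.add_apply, ← Finset.sum_add_distrib]
    refine Finset.sum_congr rfl fun e _ => ?_
    obtain ⟨⟨u, v⟩, he⟩ := e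
    rw [← mul_add]
    congr 1
    change (f u + g u) + (f v + g v) = (f u + f v) + (g u + g v)
    ring
  map_smul' c f := by
    ext x
    simp only [LinearMap.coe_mk, AddHom.coe_mk,
      LinearMap.smul_apply, RingHom.id_apply, smul_eq_mul, Finset.mul_sum]
    refine Finset.sum_congr rfl fun e _ => ?_
    obtain ⟨⟨u, v⟩, he⟩ := e
    rw [mul_left_comm]
    congr 1
    change c * f u + c * f v = c * (f u + f v)
    ring

theorem coboundaryPairing_apply [Fintype G.edgeSet] (f : V → ZMod 2) (x : G.edgeSet → ZMod 2) :
    G.coboundaryPairing f x = ∑ e, x e * endSum f e.1 := rfl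

/-- The sum telescopes along the walk. For a closed walk it vanishes, so the edge chain is
annihilated by all coboundaries. -/
theorem Walk.sum_count_mul_endSum [DecidableEq V] [Fintype G.edgeSet] (f : V → ZMod 2) {u v : V}
    (p : G.Walk u v) :
    ∑ e : G.edgeSet, (p.edges.count e.1 : ZMod 2) * endSum f e.1 = f u + f v := by
  induction p with
  | nil => simp [CharTwo.add_self_eq_zero]
  | @cons u v w h p ih =>
    have h1 : ∀ e : G.edgeSet, ((Walk.cons h p).edges.count e.1 : ZMod 2) * endSum f e.1 =
        (p.edges.count e.1 : ZMod 2) * endSum f e.1 +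
          if (⟨s(u, v), h⟩ : G.edgeSet) = e then endSum f e.1 else 0 := by
      intro e
      rw [Walk.edges_cons, List.count_cons]
      by_cases he : (⟨s(u, v), h⟩ : G.edgeSet) = e
      · have : s(u, v) = e.1 := congrArg Subtype.val he
        simp [this, add_mul]
      · have : s(u, v) ≠ e.1 := fun h' => he (Subtype.ext h')
        simp [he, this]
    rw [Finset.sum_congr rfl fun e _ => h1 e, Finset.sum_add_distrib, ih, Finset.sum_ite_eq]
    simp only [Finset.mem_univ, if_true, endSum_mk]
    have := CharTwo.add_self_eq_zero (f v)
    linear_combination this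

namespace RotationSystem

variable (R : G.RotationSystem)

/-- The face to the left of a dart. -/
def face (d : G.Dart) : R.Face := Quotient.mk (Equiv.Perm.SameCycle.setoid R.next) d

theorem next_symm (d : G.Dart) : R.next d.symm = R.rot d := by
  change R.rot d.symm.symm = _
  rw [Dart.symm_symm]

theorem face_next (d : G.Dart) : R.face (R.next d) = R.face d :=
  Quotient.sound (show R.next.SameCycle _ _ from Equiv.Perm.sameCycle_apply_left.2 (.refl _ _))

theorem face_symm (d : G.Dart) : R.face d.symm = R.face (R.rot d) := by
  rw [← next_symm, face_next]

/-- Rotation is transitive on the darts at a vertex and reversal crosses an edge, so in a connected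
graph the two moves reach every dart. -/
theorem eq_of_invariant {α : Type*} [Finite V] (hG : G.Connected) (g : G.Dart → α)
    (h1 : ∀ d, g (R.rot d) = g d) (h2 : ∀ d, g d.symm = g d) (d e : G.Dart) : g d = g e := by
  have key : ∀ u v (p : G.Walk u v) (d e : G.Dart), d.fst = u → e.fst = v → g d = g e := by
    intro u v p
    have hcyc : ∀ d e : G.Dart, d.fst = e.fst → g d = g e := by
      intro d e hde
      have : Finite G.Dart := .of_injective _ (Dart.toProd_injective)
      obtain ⟨i, -, rfl⟩ := (R.rot_cyclic d e hde).exists_pow_eq'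
      clear hde
      induction i with
      | zero => rfl
      | succ k ih => rw [pow_succ', Equiv.Perm.mul_apply, h1]; exact ih
    induction p with
    | nil => exact fun d e hd he => hcyc d e (hd.trans he.symm)
    | @cons u v w h p ih =>
      intro d e hd he
      rw [hcyc d ⟨(u, v), h⟩ hd, ← h2]
      exact ih _ _ rfl he
  obtain ⟨p⟩ := hG.preconnected d.fst e.fst
  exact key _ _ p d e rfl rfl

/-- A chosen dart on each edge. -/
noncomputable def _root_.SimpleGraph.edgeDart (e : G.edgeSet) : G.Dart :=
  (show ∃ d : G.Dart, d.edge = e.1 by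
    obtain ⟨⟨u, v⟩, he⟩ := e
    exact ⟨⟨(u, v), he⟩, rfl⟩).choose

theorem _root_.SimpleGraph.edgeDart_edge (e : G.edgeSet) : (edgeDart e).edge = e.1 :=
  (show ∃ d : G.Dart, d.edge = e.1 by
    obtain ⟨⟨u, v⟩, he⟩ := e
    exact ⟨⟨(u, v), he⟩, rfl⟩).choose_spec

/-- The mod 2 boundary of a set of faces. -/
noncomputable def faceBoundary : (R.Face → ZMod 2) →ₗ[ZMod 2] (G.edgeSet → ZMod 2) where
  toFun φ e := φ (R.face (edgeDart e)) + φ (R.face (edgeDart e).symm)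
  map_add' φ ψ := by
    ext e
    simp only [Pi.add_apply]
    ring
  map_smul' c φ := by
    ext e
    simp only [Pi.smul_apply, RingHom.id_apply, smul_eq_mul]
    ring

theorem faceBoundary_edge (φ : R.Face → ZMod 2) (d : G.Dart) :
    R.faceBoundary φ ⟨d.edge, d.edge_mem⟩ = φ (R.face d) + φ (R.face d.symm) := by
  change φ (R.face (edgeDart _)) + φ (R.face (edgeDart _).symm) = _
  rcases (dart_edge_eq_iff _ _).1 (edgeDart_edge (⟨d.edge, d.edge_mem⟩ : G.edgeSet)) with h | h
  · rw [h]
  · rw [h, Dart.symm_symm, add_comm]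

/-- Sorted by darts, each dart contributes `f` at its tail times the colours of its two sides. The
side of `d.symm` is the side of `rot d`, so reindexing by `rot`, which fixes tails, makes the two
halves cancel mod 2. -/
theorem sum_faceBoundary_mul_endSum [Fintype V] [Fintype G.edgeSet] (φ : R.Face → ZMod 2)
    (f : V → ZMod 2) : ∑ e, R.faceBoundary φ e * endSum f e.1 = 0 := by
  classical
  have : Finite G.Dart := .of_injective _ (Dart.toProd_injective)
  have := Fintype.ofFinite G.Dart
  have h1 : ∀ e : G.edgeSet, R.faceBoundary φ e * endSum f e.1 =
      ∑ d : G.Dart with (⟨d.edge, d.edge_mem⟩ : G.edgeSet) = e,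
        f d.fst * (φ (R.face d) + φ (R.face d.symm)) := by
    intro e
    obtain ⟨d, rfl⟩ : ∃ d : G.Dart, (⟨d.edge, d.edge_mem⟩ : G.edgeSet) = e :=
      ⟨edgeDart e, Subtype.ext (edgeDart_edge e)⟩
    have h2 : (Finset.univ.filter fun d' : G.Dart =>
        (⟨d'.edge, d'.edge_mem⟩ : G.edgeSet) = ⟨d.edge, d.edge_mem⟩) = {d, d.symm} := by
      ext d'
      simp [dart_edge_eq_iff]
    rw [h2, Finset.sum_pair d.symm_ne.symm, faceBoundary_edge, endSum_edge, Dart.symm_symm]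
    change _ = _ + f d.snd * _
    ring
  rw [Finset.sum_congr rfl fun e _ => h1 e, Finset.sum_fiberwise]
  simp only [mul_add, Finset.sum_add_distrib, face_symm]
  rw [← Equiv.sum_comp R.rot (fun d => f d.fst * φ (R.face d))]
  simp only [R.rot_fst]
  exact CharTwo.add_self_eq_zero _

end RotationSystem

end SimpleGraph

/-! ### The combinatorial Jordan curve theorem. -/

namespace PlaneEmbedding

open SimpleGraph Module

variable {V : Type*} [Finite V] {G : SimpleGraph V} (M : PlaneEmbedding G)

/-- Combinatorial Jordan curve theorem: every closed walk is a mod 2 boundary. -/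
theorem exists_face_colouring [DecidableEq V] {u : V} (p : G.Walk u u) :
    ∃ φ : M.Face → ZMod 2, ∀ d : G.Dart,
      φ (M.face (M.rot d)) = φ (M.face d) + (p.edges.count d.edge : ZMod 2) := by
  classical
  have := Fintype.ofFinite V
  have : Finite G.Dart := .of_injective _ (Dart.toProd_injective)
  have : Finite M.Face := Quotient.finite _
  have := Fintype.ofFinite M.Face
  have := Fintype.ofFinite G.edgeSet
  have eul := M.euler
  simp only [Nat.card_eq_fintype_card] at eul
  have hker1 : finrank (ZMod 2) (LinearMap.ker M.faceBoundary) ≤ 1 := by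
    refine finrank_le_one ⟨fun _ => 1, ?_⟩ fun ⟨φ, hφ⟩ => ?_
    · rw [LinearMap.mem_ker]
      ext e
      exact CharTwo.add_self_eq_zero (1 : ZMod 2)
    -- A colouring without boundary agrees across every edge, hence is constant by connectedness.
    · have hs : ∀ d, φ (M.face d.symm) = φ (M.face d) := by
        intro d
        have := M.faceBoundary_edge φ d
        rw [LinearMap.mem_ker.1 hφ] at this
        exact (CharTwo.add_eq_zero.1 this.symm).symm
      have hall := M.eq_of_invariant M.connected (fun d => φ (M.face d))
        (fun d => by rw [← RotationSystem.face_symm, hs]) hs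
      refine ⟨φ M.outer, Subtype.ext (funext fun F => ?_)⟩
      obtain ⟨d, hd⟩ := Quotient.exists_rep M.outer
      obtain ⟨e, rfl⟩ := Quotient.exists_rep F
      change φ M.outer * 1 = _
      rw [← hd, mul_one]
      exact hall d e
  have hker2 : finrank (ZMod 2) (LinearMap.ker G.coboundaryPairing) ≤ 1 := by
    refine finrank_le_one ⟨fun _ => 1, ?_⟩ fun ⟨f, hf⟩ => ?_
    · rw [LinearMap.mem_ker]
      refine LinearMap.ext fun x => Finset.sum_eq_zero fun e _ => ?_
      obtain ⟨⟨u, v⟩, he⟩ := e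
      change x _ * (1 + 1) = 0
      rw [CharTwo.add_self_eq_zero, mul_zero]
    · have hs : ∀ v w, G.Adj v w → f v = f w := by
        intro v w h
        have := LinearMap.congr_fun (LinearMap.mem_ker.1 hf) (Pi.single ⟨s(v, w), h⟩ 1)
        rw [coboundaryPairing_apply, Finset.sum_eq_single ⟨s(v, w), h⟩] at this
        · simpa [CharTwo.add_eq_zero] using this
        · intro b _ hb
          rw [Pi.single_eq_of_ne hb, zero_mul]
        · simp
      have hw : ∀ v w (q : G.Walk v w), f v = f w := by
        intro v w q
        induction q with
        | nil => rfl
        | cons h _ ih => exact (hs _ _ h).trans ih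
      refine ⟨f u, Subtype.ext (funext fun v => ?_)⟩
      obtain ⟨q⟩ := M.connected.preconnected u v
      simpa using hw _ _ q
  have r1 := LinearMap.finrank_range_add_finrank_ker M.faceBoundary
  have r2 := LinearMap.finrank_range_add_finrank_ker G.coboundaryPairing
  have r3 := Subspace.finrank_add_finrank_dualCoannihilator_eq
    (LinearMap.range G.coboundaryPairing)
  rw [finrank_fintype_fun_eq_card] at r1 r2 r3
  have hle : LinearMap.range M.faceBoundary ≤
      (LinearMap.range G.coboundaryPairing).dualCoannihilator := by
    rintro _ ⟨φ, rfl⟩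
    rw [Submodule.mem_dualCoannihilator]
    rintro _ ⟨f, rfl⟩
    exact M.sum_faceBoundary_mul_endSum φ f
  -- Boundaries have dimension at least F - 1, the annihilator of the coboundaries at most E - V +
  -- 1; Euler's formula makes these two numbers equal.
  have heq := Submodule.eq_of_le_of_finrank_le hle (by omega)
  have hp : (fun e : G.edgeSet => (p.edges.count e.1 : ZMod 2)) ∈
      (LinearMap.range G.coboundaryPairing).dualCoannihilator := by
    rw [Submodule.mem_dualCoannihilator]
    rintro _ ⟨f, rfl⟩
    rw [coboundaryPairing_apply, Walk.sum_count_mul_endSum, CharTwo.add_self_eq_zero]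
  rw [← heq] at hp
  obtain ⟨φ, hφ⟩ := hp
  refine ⟨φ, fun d => ?_⟩
  have h1 := M.faceBoundary_edge φ d
  rw [hφ] at h1
  change (p.edges.count d.edge : ZMod 2) = _ at h1
  rw [h1, RotationSystem.face_symm, ← add_assoc, CharTwo.add_self_eq_zero, zero_add]

end PlaneEmbedding

/-! ### Connection outside a vertex set, in blocks. -/

namespace SimpleGraph

variable {V : Type*} {G : SimpleGraph V}

theorem Dart.eq_of_fst_eq_of_edge_eq {d e : G.Dart} (h : d.fst = e.fst) (h' : d.edge = e.edge) :
    d = e := by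
  rcases (dart_edge_eq_iff _ _).1 h' with h1 | h1
  · exact h1
  · rw [h1] at h
    exact absurd h e.snd_ne_fst

/-- `a` and `b` are joined by a walk of `G` that avoids `T`. -/
def JoinedAvoiding (G : SimpleGraph V) (T : Set V) (a b : V) : Prop :=
  ∃ p : G.Walk a b, ∀ x ∈ p.support, x ∉ T

namespace JoinedAvoiding

variable {T : Set V} {a b c : V}

theorem refl (ha : a ∉ T) : G.JoinedAvoiding T a a := ⟨.nil, by simpa using ha⟩

theorem symm (h : G.JoinedAvoiding T a b) : G.JoinedAvoiding T b a := by
  obtain ⟨p, hp⟩ := h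
  exact ⟨p.reverse, by simpa using hp⟩

theorem trans (h : G.JoinedAvoiding T a b) (h' : G.JoinedAvoiding T b c) :
    G.JoinedAvoiding T a c := by
  obtain ⟨p, hp⟩ := h
  obtain ⟨q, hq⟩ := h'
  refine ⟨p.append q, fun x hx => ?_⟩
  rcases (Walk.mem_support_append_iff _ _).1 hx with hx | hx
  exacts [hp x hx, hq x hx]

theorem of_adj (h : G.Adj a b) (ha : a ∉ T) (hb : b ∉ T) : G.JoinedAvoiding T a b :=
  ⟨h.toWalk, by simp [ha, hb]⟩

theorem left_notMem (h : G.JoinedAvoiding T a b) : a ∉ T :=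
  h.elim fun p hp => hp _ p.start_mem_support

theorem right_notMem (h : G.JoinedAvoiding T a b) : b ∉ T := h.symm.left_notMem

end JoinedAvoiding

theorem joinedAvoiding_iff {T : Set V} {a b : V} (ha : a ∉ T) (hb : b ∉ T) :
    G.JoinedAvoiding T a b ↔ (G.induce Tᶜ).Reachable ⟨a, ha⟩ ⟨b, hb⟩ := by
  constructor
  · rintro ⟨p, hp⟩
    exact ⟨p.induce Tᶜ hp⟩
  · rintro ⟨p⟩
    refine ⟨p.map (Embedding.induce Tᶜ).toHom, fun x hx => ?_⟩
    have hx' : x ∈ (p.map (Embedding.induce Tᶜ).toHom).support := hx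
    rw [Walk.support_map, List.mem_map] at hx'
    obtain ⟨y, -, rfl⟩ := hx'
    exact y.2

theorem preconnected_induce_compl_iff {T : Set V} :
    (G.induce Tᶜ).Preconnected ↔ ∀ a b, a ∉ T → b ∉ T → G.JoinedAvoiding T a b :=
  ⟨fun h _ _ ha hb => (joinedAvoiding_iff ha hb).2 (h _ _),
    fun h a b => (joinedAvoiding_iff a.2 b.2).1 (h _ _ a.2 b.2)⟩

theorem IsBlock.joinedAvoiding (hG : G.IsBlock) {v a b : V} (ha : a ≠ v) (hb : b ≠ v) :
    G.JoinedAvoiding {v} a b := by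
  have := hG.2 {v}
  rw [IsSeparator, not_and, not_not, preconnected_induce_compl_iff] at this
  exact this (by simp) a b ha hb

/-- A walk that leaves the component of its start in `G - T` meets `T`. -/
theorem Walk.exists_walk_to_first_mem {T : Set V} {x y : V} (p : G.Walk x y) (hx : x ∉ T)
    (hxy : ¬ G.JoinedAvoiding T x y) :
    ∃ z ∈ T, z ∈ p.support ∧ ∃ q : G.Walk x z,
      ∀ u ∈ q.support, u = z ∨ G.JoinedAvoiding T x u := by
  induction p with
  | nil => exact absurd (.refl hx) hxy
  | @cons x v y h p ih =>
    by_cases hv : v ∈ T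
    · refine ⟨v, hv, by simp, h.toWalk, fun u hu => ?_⟩
      rcases (by simpa using hu : u = x ∨ u = v) with rfl | rfl
      exacts [Or.inr (.refl hx), Or.inl rfl]
    · have hxv := JoinedAvoiding.of_adj h hx hv
      obtain ⟨z, hz, hzp, q, hq⟩ := ih hv fun h' => hxy (hxv.trans h')
      refine ⟨z, hz, by simp [hzp], .cons h q, fun u hu => ?_⟩
      rw [Walk.support_cons, List.mem_cons] at hu
      rcases hu with rfl | hu
      · exact Or.inr (.refl hx)
      · exact (hq u hu).imp id hxv.trans

/-- If `{c, d}` separates a block and does not separate `a` from the remaining vertices, some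
path from `c` to `d` avoids the component of `a`. -/
theorem IsBlock.exists_walk_avoiding_component (hG : G.IsBlock) {c d a : V}
    (hs : G.IsSeparator 2 {c, d}) (ha : a ∉ ({c, d} : Set V)) :
    ∃ q : G.Walk c d, ∀ u ∈ q.support, ¬ G.JoinedAvoiding {c, d} a u := by
  obtain ⟨x, hx, hxa⟩ : ∃ x, x ∉ ({c, d} : Set V) ∧ ¬ G.JoinedAvoiding {c, d} x a := by
    by_contra! h
    exact hs.2 (preconnected_induce_compl_iff.2 fun u v hu hv => (h u hu).trans (h v hv).symm)
  have key : ∀ z ∈ ({c, d} : Set V), ∃ q : G.Walk x z,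
      ∀ u ∈ q.support, ¬ G.JoinedAvoiding {c, d} a u := by
    intro z hz
    obtain ⟨z', hz', hzz⟩ : ∃ z' ∈ ({c, d} : Set V), ∀ y ∈ ({c, d} : Set V), y ≠ z' → y = z := by
      rcases hz with rfl | rfl
      · exact ⟨d, by simp, by simp +contextual⟩
      · exact ⟨c, by simp, by simp +contextual⟩
    -- A walk from `x` to `a` that avoids the other separator vertex `z'` must leave the component
    -- of `x` through `z`.
    obtain ⟨p, hp⟩ := hG.joinedAvoiding (v := z') (a := x) (b := a)
      (fun h => hx (h ▸ hz')) (fun h => ha (h ▸ hz'))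
    obtain ⟨y, hy, hyp, q, hq⟩ := p.exists_walk_to_first_mem hx hxa
    obtain rfl := hzz y hy (hp y hyp)
    refine ⟨q, fun u hu h => ?_⟩
    rcases hq u hu with rfl | h'
    · exact h.right_notMem hy
    · exact hxa (h'.trans h.symm)
  obtain ⟨q₁, h₁⟩ := key c (by simp)
  obtain ⟨q₂, h₂⟩ := key d (by simp)
  refine ⟨q₁.reverse.append q₂, fun u hu => ?_⟩
  rcases (Walk.mem_support_append_iff _ _).1 hu with hu | hu
  · exact h₁ u (by simpa using hu)
  · exact h₂ u hu

end SimpleGraph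

/-! ### The outer face of a block visits no vertex twice. -/

namespace PlaneEmbedding

open SimpleGraph

variable {V : Type*} [Finite V] {G : SimpleGraph V} (M : PlaneEmbedding G)

theorem exists_rot_iterate {d e : G.Dart} (h : d.fst = e.fst) : ∃ i, M.rot^[i] d = e := by
  have : Finite G.Dart := .of_injective _ (Dart.toProd_injective)
  obtain ⟨i, -, hi⟩ := (M.rot_cyclic d e h).exists_pow_eq'
  exact ⟨i, by rw [Equiv.Perm.iterate_eq_pow, hi]⟩

theorem rot_iterate_fst (d : G.Dart) (i : ℕ) : (M.rot^[i] d).fst = d.fst := by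
  induction i with
  | zero => rfl
  | succ k ih => rw [Function.iterate_succ_apply', M.rot_fst, ih]

variable {M}

theorem IsOuter.face_eq {d : G.Dart} (hd : M.IsOuter d) : M.face d = M.outer := hd

theorem IsOuter.next {d : G.Dart} (hd : M.IsOuter d) : M.IsOuter (M.next d) :=
  (M.face_next d).trans hd

theorem IsOuter.iterate {d : G.Dart} (hd : M.IsOuter d) (k : ℕ) : M.IsOuter (M.next^[k] d) := by
  induction k with
  | zero => exact hd
  | succ k ih => rw [Function.iterate_succ_apply']; exact ih.next

/-- The outer face of a block visits each vertex at most once. -/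
theorem IsOuter.eq_of_fst_eq (hG : G.IsBlock) {d e : G.Dart} (hd : M.IsOuter d)
    (he : M.IsOuter e) (h : d.fst = e.fst) : d = e := by
  classical
  by_contra hne
  obtain ⟨q, hq⟩ := hG.joinedAvoiding (v := d.fst) (a := d.snd) (b := e.snd) d.snd_ne_fst
    (h ▸ e.snd_ne_fst)
  have hea : G.Adj e.snd d.fst := h ▸ e.adj.symm
  -- At the common tail this closed walk uses only the edges of `d` and `e`, so it separates the two
  -- corners there that would both belong to the outer face.
  obtain ⟨φ, hφ⟩ := M.exists_face_colouring (.cons d.adj (q.concat hea))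
  have hcount : ∀ x : G.Dart, x.fst = d.fst →
      (Walk.cons d.adj (q.concat hea)).edges.count x.edge =
        (if d = x then 1 else 0) + (if e = x then 1 else 0) := by
    intro x hx
    have h0 : q.edges.count x.edge = 0 := List.count_eq_zero_of_not_mem fun hmem =>
      hq _ (Walk.fst_mem_support_of_mem_edges q hmem) hx
    have h1 : s(d.fst, d.snd) = x.edge ↔ d = x :=
      ⟨fun h' => Dart.eq_of_fst_eq_of_edge_eq hx.symm h', fun h' => h' ▸ rfl⟩
    have h2 : s(e.snd, d.fst) = x.edge ↔ e = x := by
      rw [h, Sym2.eq_swap]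
      exact ⟨fun h' => Dart.eq_of_fst_eq_of_edge_eq (h.symm.trans hx.symm) h', fun h' => h' ▸ rfl⟩
    rw [Walk.edges_cons, Walk.edges_concat, List.count_cons, List.concat_eq_append,
      List.count_append, h0, List.count_singleton]
    simp only [beq_iff_eq, h1, h2]
    omega
  have hex := M.exists_rot_iterate h
  have hmin := fun {i} => Nat.find_min hex (m := i)
  have hspec := Nat.find_spec hex
  set m := Nat.find hex
  -- Rotating from `d` to the first occurrence of `e` crosses the edge of `d` once and no other edge
  -- of the closed walk.
  have key : ∀ i < m, φ (M.face (M.rot^[i + 1] d)) = φ (M.face d) + 1 := by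
    intro i hi
    induction i with
    | zero =>
      rw [Function.iterate_succ_apply', hφ, Function.iterate_zero_apply, hcount _ rfl]
      simp [Ne.symm hne]
    | succ k ih =>
      rw [Function.iterate_succ_apply', hφ, ih (by omega), hcount _ (M.rot_iterate_fst _ _)]
      rw [if_neg, if_neg]
      · simp
      · exact fun h' => hmin hi h'.symm
      -- An early return to `d` would let `e` be reached in fewer than `m` rotations.
      · intro h'
        refine hmin (i := m - (k + 1)) (by omega) ?_
        rw [← hspec]
        nth_rw 2 [show m = (m - (k + 1)) + (k + 1) by omega]
        rw [Function.iterate_add_apply, ← h']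
  have hm : m ≠ 0 := fun h0 => hne (by rw [h0] at hspec; exact hspec)
  have := key (m - 1) (by omega)
  rw [Nat.sub_add_cancel (by omega), hspec, hd.face_eq, he.face_eq] at this
  simp at this

/-! ### Cyclic coordinates on the outer face. -/

variable (M)

/-- The `k`-th vertex of the facial walk that starts with `d`. -/
def walkVert (d : G.Dart) (k : ℕ) : V := (M.next^[k] d).fst

/-- The length of the facial walk through `d`. -/
noncomputable def faceLength (d : G.Dart) : ℕ := Function.minimalPeriod M.next d

theorem iterate_edge (d : G.Dart) (k : ℕ) :
    (M.next^[k] d).edge = s(M.walkVert d k, M.walkVert d (k + 1)) := by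
  rw [walkVert, walkVert, M.iterate_succ_fst]
  rfl

theorem walkVert_adj (d : G.Dart) (k : ℕ) : G.Adj (M.walkVert d k) (M.walkVert d (k + 1)) := by
  rw [← mem_edgeSet, ← M.iterate_edge]
  exact Dart.edge_mem _

theorem faceLength_pos (d : G.Dart) : 0 < M.faceLength d := by
  have : Finite G.Dart := .of_injective _ (Dart.toProd_injective)
  exact Function.minimalPeriod_pos_of_mem_periodicPts (M.next.injective.mem_periodicPts d)

theorem faceLength_iterate (d : G.Dart) (k : ℕ) :
    M.faceLength (M.next^[k] d) = M.faceLength d :=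
  Function.minimalPeriod_apply_iterate
    (Function.minimalPeriod_pos_iff_mem_periodicPts.1 (M.faceLength_pos d)) k

theorem walkVert_add_faceLength (d : G.Dart) (k : ℕ) :
    M.walkVert d (k + M.faceLength d) = M.walkVert d k := by
  rw [walkVert, faceLength, Function.iterate_add_minimalPeriod_eq, walkVert]

theorem walkVert_iterate (d : G.Dart) (i k : ℕ) :
    M.walkVert (M.next^[i] d) k = M.walkVert d (i + k) := by
  rw [walkVert, walkVert, ← Function.iterate_add_apply, add_comm]

variable {M}

theorem IsOuter.walkVert_mem {d : G.Dart} (hd : M.IsOuter d) (k : ℕ) :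
    M.walkVert d k ∈ M.outerVerts := ⟨_, hd.iterate k, rfl⟩

theorem IsOuter.exists_iterate_eq {d e : G.Dart} (hd : M.IsOuter d) (he : M.IsOuter e) (m : ℕ) :
    ∃ k, m ≤ k ∧ k < m + M.faceLength d ∧ M.next^[k] d = e := by
  have : Finite G.Dart := .of_injective _ (Dart.toProd_injective)
  have hs : M.next.SameCycle (M.next^[m] d) e := Quotient.exact ((hd.iterate m).trans he.symm)
  obtain ⟨i, -, hi⟩ := hs.exists_pow_eq'
  refine ⟨i % M.faceLength d + m, by omega,
    by have := Nat.mod_lt i (M.faceLength_pos d); omega, ?_⟩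
  have hper : Function.IsPeriodicPt M.next (M.faceLength d) (M.next^[m] d) :=
    (Function.isPeriodicPt_minimalPeriod M.next d).apply_iterate m
  rw [Function.iterate_add_apply, hper.iterate_mod_apply, Equiv.Perm.iterate_eq_pow, hi]

theorem IsOuter.exists_walkVert_eq {d : G.Dart} (hd : M.IsOuter d) {x : V}
    (hx : x ∈ M.outerVerts) (m : ℕ) :
    ∃ k, m ≤ k ∧ k < m + M.faceLength d ∧ M.walkVert d k = x := by
  obtain ⟨e, he, rfl⟩ := hx
  obtain ⟨k, h1, h2, rfl⟩ := hd.exists_iterate_eq he m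
  exact ⟨k, h1, h2, rfl⟩

theorem IsOuter.walkVert_ne (hG : G.IsBlock) {d : G.Dart} (hd : M.IsOuter d) {i j : ℕ}
    (hij : i < j) (hj : j < i + M.faceLength d) : M.walkVert d i ≠ M.walkVert d j := by
  intro h
  have h1 := (hd.iterate i).eq_of_fst_eq hG (hd.iterate j) h
  rw [show j = i + (j - i) by omega, Function.iterate_add_apply] at h1
  have h2 : Function.IsPeriodicPt M.next (j - i) d :=
    ((M.next.injective.iterate i) h1).symm
  have := h2.minimalPeriod_le (by omega)
  rw [faceLength] at hj
  omega

theorem IsOuter.walkVert_inj (hG : G.IsBlock) {d : G.Dart} (hd : M.IsOuter d) {i j : ℕ}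
    (h : M.walkVert d i = M.walkVert d j) (hi : i < j + M.faceLength d)
    (hj : j < i + M.faceLength d) : i = j := by
  rcases lt_trichotomy i j with h' | h' | h'
  · exact absurd h (hd.walkVert_ne hG h' hj)
  · exact h'
  · exact absurd h.symm (hd.walkVert_ne hG h' hi)

/-- Matching two edges in opposite directions would force the length to be 2, where the facial walk
runs along one edge and back. -/
theorem IsOuter.edge_inj (hG : G.IsBlock) {d : G.Dart} (hd : M.IsOuter d) {i j : ℕ}
    (hn : 3 ≤ M.faceLength d)
    (h : s(M.walkVert d i, M.walkVert d (i + 1)) = s(M.walkVert d j, M.walkVert d (j + 1)))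
    (hi : i < j + M.faceLength d) (hj : j < i + M.faceLength d) : i = j := by
  rcases Sym2.eq_iff.1 h with ⟨h1, -⟩ | ⟨h1, h2⟩
  · exact hd.walkVert_inj hG h1 hi hj
  · by_contra hne
    by_cases hji : j + 1 < i + M.faceLength d
    · have := hd.walkVert_inj hG h1 (by omega) hji
      have := hd.walkVert_inj hG h2 (by omega) (by omega)
      omega
    · have := hd.walkVert_inj hG h2 (by omega) (by omega)
      omega

/-- Turns paths of C into index intervals. The starting dart is unique, and `j < i + M.faceLength d`
ensures that the end vertex is met for the first time at index `j`. -/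
theorem IsOuter.mem_arc (hG : G.IsBlock) {d : G.Dart} (hd : M.IsOuter d) {i j : ℕ} (hij : i ≤ j)
    (hj : j < i + M.faceLength d) {z : V} :
    z ∈ (M.arc (M.walkVert d i) (M.walkVert d j)).verts ↔
      ∃ k, i ≤ k ∧ k ≤ j ∧ M.walkVert d k = z := by
  constructor
  · rintro ⟨e, k, he, hfst, hz, hne⟩
    obtain rfl := (hd.iterate i).eq_of_fst_eq hG he hfst.symm
    change M.walkVert _ k = z at hz
    rw [M.walkVert_iterate] at hz
    refine ⟨i + k, by omega, ?_, hz⟩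
    by_contra! hlt
    refine hne (j - i) (by omega) ?_
    change M.walkVert _ _ = _
    rw [M.walkVert_iterate, Nat.add_sub_of_le hij]
  · rintro ⟨k, hik, hkj, rfl⟩
    refine ⟨_, k - i, hd.iterate i, rfl, ?_, fun m hm => ?_⟩
    · change M.walkVert _ _ = _
      rw [M.walkVert_iterate, Nat.add_sub_of_le hik]
    · change M.walkVert _ _ ≠ _
      rw [M.walkVert_iterate]
      exact hd.walkVert_ne hG (by omega) (by omega)

theorem IsOuter.arc_adj (hG : G.IsBlock) {d : G.Dart} (hd : M.IsOuter d) {i j : ℕ} (hij : i ≤ j)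
    (hj : j < i + M.faceLength d) {z w : V} :
    (M.arc (M.walkVert d i) (M.walkVert d j)).Adj z w ↔
      ∃ k, i ≤ k ∧ k < j ∧ s(M.walkVert d k, M.walkVert d (k + 1)) = s(z, w) := by
  constructor
  · rintro ⟨e, k, he, hfst, hz, hne⟩
    obtain rfl := (hd.iterate i).eq_of_fst_eq hG he hfst.symm
    rw [M.iterate_edge, M.walkVert_iterate, M.walkVert_iterate] at hz
    refine ⟨i + k, by omega, ?_, hz⟩
    by_contra! hlt
    refine hne (j - i) (by omega) ?_
    change M.walkVert _ _ = _
    rw [M.walkVert_iterate, Nat.add_sub_of_le hij]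
  · rintro ⟨k, hik, hkj, hz⟩
    refine ⟨_, k - i, hd.iterate i, rfl, ?_, fun m hm => ?_⟩
    · rw [M.iterate_edge, M.walkVert_iterate, M.walkVert_iterate, ← add_assoc,
        Nat.add_sub_of_le hik, hz]
    · change M.walkVert _ _ ≠ _
      rw [M.walkVert_iterate]
      exact hd.walkVert_ne hG (by omega) (by omega)

/-! ### A 2-separator on the outer cycle separates its two sides. -/

variable (M)

/-- The facial walk from the `j`-th vertex on, of length `m`. -/
def facialWalk (d : G.Dart) (j : ℕ) : ∀ m, G.Walk (M.walkVert d j) (M.walkVert d (j + m))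
  | 0 => .nil
  | m + 1 => (facialWalk d j m).concat (M.walkVert_adj d (j + m))

theorem facialWalk_edges (d : G.Dart) (j m : ℕ) : (M.facialWalk d j m).edges =
    (List.range m).map fun t => s(M.walkVert d (j + t), M.walkVert d (j + t + 1)) := by
  induction m with
  | zero => rfl
  | succ m ih =>
    rw [facialWalk, Walk.edges_concat, ih, List.range_succ, List.map_append,
      List.concat_eq_append]
    rfl

theorem mem_facialWalk_edges {d : G.Dart} {j m : ℕ} {x : Sym2 V} :
    x ∈ (M.facialWalk d j m).edges ↔ ∃ k, j ≤ k ∧ k < j + m ∧ (M.next^[k] d).edge = x := by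
  simp only [facialWalk_edges, List.mem_map, List.mem_range, iterate_edge]
  constructor
  · rintro ⟨t, ht, rfl⟩
    exact ⟨j + t, by omega, by omega, rfl⟩
  · rintro ⟨k, h1, h2, rfl⟩
    exact ⟨k - j, by omega, by rw [Nat.add_sub_of_le h1]⟩

variable {M}

theorem IsOuter.count_facialWalk_edges [DecidableEq V] (hG : G.IsBlock) {d : G.Dart}
    (hd : M.IsOuter d) (hn : 3 ≤ M.faceLength d) {j m k : ℕ} (hm : m ≤ M.faceLength d)
    (hjk : j ≤ k) (hk : k < j + m) :
    (M.facialWalk d j m).edges.count (M.next^[k] d).edge = 1 := by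
  refine List.count_eq_one_of_mem ?_ (M.mem_facialWalk_edges.2 ⟨k, hjk, hk, rfl⟩)
  rw [facialWalk_edges]
  refine List.Nodup.map_on (fun x hx y hy h => ?_) List.nodup_range
  rw [List.mem_range] at hx hy
  have := hd.edge_inj hG hn h (by omega) (by omega)
  omega

theorem IsOuter.joinedAvoiding_arc (hG : G.IsBlock) {d : G.Dart} (hd : M.IsOuter d) {i j : ℕ}
    (hj : j ≤ i + M.faceLength d) {t t' : ℕ} (ht : i < t) (htj : t < j) (ht' : i < t')
    (htj' : t' < j) :
    G.JoinedAvoiding {M.walkVert d i, M.walkVert d j} (M.walkVert d t) (M.walkVert d t') := by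
  have hT : ∀ t, i < t → t < j → M.walkVert d t ∉ ({M.walkVert d i, M.walkVert d j} : Set V) := by
    rintro t h1 h2 (h | h)
    · exact hd.walkVert_ne hG h1 (by omega) h.symm
    · exact hd.walkVert_ne hG h2 (by omega) h
  have hup : ∀ t t', i < t → t ≤ t' → t' < j →
      G.JoinedAvoiding {M.walkVert d i, M.walkVert d j} (M.walkVert d t) (M.walkVert d t') := by
    intro t t' h1 h2 h3
    induction t', h2 using Nat.le_induction with
    | base => exact .refl (hT t h1 h3)
    | succ t' h2 ih =>
      exact (ih (by omega)).trans
        (.of_adj (M.walkVert_adj d t') (hT _ (by omega) (by omega)) (hT _ (by omega) h3))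
  rcases le_total t t' with h | h
  · exact hup t t' ht h htj'
  · exact (hup t' t ht' h htj).symm

/-- A 2-separator formed by two vertices of the outer cycle of a block separates the two sides
of the cycle. -/
theorem IsOuter.not_joinedAvoiding (hG : G.IsBlock) {d : G.Dart} (hd : M.IsOuter d)
    {i k j l : ℕ} (hik : i < k) (hkj : k < j) (hjl : j < l) (hl : l < i + M.faceLength d)
    (hs : G.IsSeparator 2 {M.walkVert d i, M.walkVert d j}) :
    ¬ G.JoinedAvoiding {M.walkVert d i, M.walkVert d j} (M.walkVert d k) (M.walkVert d l) := by
  classical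
  intro hkl
  -- Closing `q` by the arc from `j` to `i + n` gives a closed walk which, within the component of
  -- the `k`-th vertex, uses only edges of that arc.
  obtain ⟨q, hq⟩ := hG.exists_walk_avoiding_component hs hkl.left_notMem
  set T : Set V := {M.walkVert d i, M.walkVert d j} with hT
  set n := M.faceLength d with hn
  have hend : M.walkVert d (j + (i + n - j)) = M.walkVert d i := by
    rw [show j + (i + n - j) = i + n by omega, hn, M.walkVert_add_faceLength]
  obtain ⟨φ, hφ⟩ := M.exists_face_colouring
    (q.append ((M.facialWalk d j (i + n - j)).copy rfl hend))
  simp only [Walk.edges_append, List.count_append, Walk.edges_copy] at hφ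
  have hq0 : ∀ x : G.Dart, G.JoinedAvoiding T (M.walkVert d k) x.fst →
      q.edges.count x.edge = 0 := fun x hx => List.count_eq_zero_of_not_mem fun hmem =>
    hq _ (Walk.fst_mem_support_of_mem_edges q hmem) hx
  have harc : ∀ t, j < t → t < i + n →
      G.JoinedAvoiding T (M.walkVert d k) (M.walkVert d t) := by
    intro t h1 h2
    have := hd.joinedAvoiding_arc hG (j := i + n) (by omega) hjl hl h1 h2
    rw [hn, M.walkVert_add_faceLength, Set.pair_comm] at this
    exact hkl.trans this
  -- At an inner vertex of the arc, rotation from the outgoing outer dart crosses its edge and flips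
  -- the colour; the next edge of the closed walk is the incoming arc edge, and crossing it returns
  -- to the outer dart.
  have hinner : ∀ t, j < t → t < i + n → ∀ e : G.Dart, e.fst = M.walkVert d t →
      e = M.next^[t] d ∨ φ (M.face e) = φ M.outer + 1 := by
    intro t h1 h2 e he
    obtain ⟨r, rfl⟩ := M.exists_rot_iterate (d := M.next^[t] d) (e := e) he.symm
    clear he
    induction r with
    | zero => exact Or.inl rfl
    | succ r ih =>
      rw [Function.iterate_succ_apply']
      have hfst : (M.rot^[r] (M.next^[t] d)).fst = M.walkVert d t := M.rot_iterate_fst _ _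
      have h0 := hq0 (M.rot^[r] (M.next^[t] d)) (by rw [hfst]; exact harc t h1 h2)
      rcases ih with ih | ih
      · right
        rw [hφ, h0, ih, (hd.iterate t).face_eq,
          hd.count_facialWalk_edges hG (by omega) (by omega) h1.le (by omega)]
        simp
      · by_cases hmem : (M.rot^[r] (M.next^[t] d)).edge ∈ (M.facialWalk d j (i + n - j)).edges
        · obtain ⟨t', -, -, ht'⟩ := M.mem_facialWalk_edges.1 hmem
          rcases (dart_edge_eq_iff _ _).1 ht' with h | h
          · have h3 : M.rot^[r] (M.next^[t] d) = M.next^[t] d :=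
              IsOuter.eq_of_fst_eq hG (h ▸ hd.iterate t') (hd.iterate t) hfst
            rw [h3, (hd.iterate t).face_eq] at ih
            simp at ih
          · left
            refine IsOuter.eq_of_fst_eq hG ?_ (hd.iterate t) (by rw [M.rot_fst, hfst]; rfl)
            rw [← M.next_symm, ← h]
            exact (hd.iterate t').next
        · right
          rw [hφ, h0, ih, List.count_eq_zero_of_not_mem hmem]
          simp
  have hout : ∀ e : G.Dart, G.JoinedAvoiding T (M.walkVert d k) e.fst →
      (∀ t, j < t → t < i + n → e.fst ≠ M.walkVert d t) →
      φ (M.face (M.rot e)) = φ (M.face e) := by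
    intro e he hne
    rw [hφ, hq0 e he, List.count_eq_zero_of_not_mem]
    · simp
    · intro hmem
      obtain ⟨t, h1, h2, h3⟩ := M.mem_facialWalk_edges.1 hmem
      have h4 : e.fst ∈ (M.next^[t] d).edge := by rw [h3]; exact Sym2.mem_mk_left _ _
      have key : ∀ t, j ≤ t → t ≤ i + n → e.fst ≠ M.walkVert d t := by
        intro t h1 h2 h5
        rcases h1.eq_or_lt with rfl | h1
        · exact he.right_notMem (by rw [h5]; simp [hT])
        · rcases h2.eq_or_lt with rfl | h2
          · exact he.right_notMem (by rw [h5, hn, M.walkVert_add_faceLength]; simp [hT])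
          · exact hne t h1 h2 h5
      rw [M.iterate_edge, Sym2.mem_iff] at h4
      rcases h4 with h4 | h4
      · exact key t h1 (by omega) h4
      · exact key (t + 1) (by omega) (by omega) h4
  -- Before it meets the arc, the walk sees only the outer colour. It cannot enter the arc from a
  -- face corner of the other colour, and entry along the outgoing outer dart would come from
  -- another arc vertex or from `T`.
  have hwalk : ∀ u w (p : G.Walk u w), w = M.walkVert d l → (∀ x ∈ p.support, x ∉ T) →
      G.JoinedAvoiding T (M.walkVert d k) u →
      (∀ t, j < t → t < i + n → u ≠ M.walkVert d t) →
      (∃ e : G.Dart, e.fst = u ∧ φ (M.face e) = φ M.outer) → False := by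
    intro u w p
    induction p with
    | nil => exact fun hw _ _ hne _ => hne l hjl hl hw
    | @cons u v w h p ih =>
      rintro hw hp hu hne ⟨e, he, hφe⟩
      have hconst : ∀ e' : G.Dart, e'.fst = u → φ (M.face e') = φ M.outer := by
        intro e' he'
        obtain ⟨r, rfl⟩ := M.exists_rot_iterate (he.trans he'.symm)
        clear he'
        induction r with
        | zero => exact hφe
        | succ r ih' =>
          have hfst : (M.rot^[r] e).fst = u := (M.rot_iterate_fst _ _).trans he
          rw [Function.iterate_succ_apply', hout _ (hfst ▸ hu) (hfst ▸ hne), ih']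
      have hv : φ (M.face (Dart.symm ⟨(u, v), h⟩)) = φ M.outer := by
        rw [M.face_symm]
        exact hconst _ (M.rot_fst _)
      have hvT : v ∉ T := hp v (by simp)
      refine ih hw (fun x hx => hp x (by simp [hx]))
        (hu.trans (.of_adj h hu.right_notMem hvT)) ?_ ⟨_, rfl, hv⟩
      rintro t h1 h2 rfl
      rcases hinner t h1 h2 (Dart.symm ⟨(u, _), h⟩) rfl with h3 | h3
      · have h4 : u = M.walkVert d (t + 1) := by
          rw [walkVert, M.iterate_succ_fst, ← h3]
          rfl
        by_cases h5 : t + 1 = i + n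
        · rw [h5, hn, M.walkVert_add_faceLength] at h4
          exact hu.right_notMem (by rw [h4]; simp [hT])
        · exact hne (t + 1) (by omega) (by omega) h4
      · simpa using hv.symm.trans h3
  obtain ⟨p, hp⟩ := hkl
  refine hwalk _ _ p rfl hp (.refl (hp _ p.start_mem_support)) (fun t h1 h2 => ?_)
    ⟨_, rfl, congrArg φ (hd.iterate k).face_eq⟩
  exact hd.walkVert_ne hG (by omega) (by omega)

end PlaneEmbedding

/-! ### Components, uncrossing and attachments. -/

namespace SimpleGraph

variable {V : Type*} {G : SimpleGraph V}

theorem IsSeparator.pair_ne {c d : V} (h : G.IsSeparator 2 {c, d}) : c ≠ d := by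
  rintro rfl
  have := h.1
  simp at this

theorem mem_image_supp_iff {T : Set V} {x z : V} (hx : x ∈ Tᶜ) :
    z ∈ Subtype.val '' ((G.induce Tᶜ).connectedComponentMk ⟨x, hx⟩).supp ↔
      G.JoinedAvoiding T x z := by
  constructor
  · rintro ⟨z, hz, rfl⟩
    rw [ConnectedComponent.mem_supp_iff] at hz
    exact ((joinedAvoiding_iff hx z.2).2 (ConnectedComponent.exact hz).symm)
  · intro h
    refine ⟨⟨z, h.right_notMem⟩, ?_, rfl⟩
    rw [ConnectedComponent.mem_supp_iff]
    exact ConnectedComponent.sound ((joinedAvoiding_iff hx _).1 h).symm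

/-- Uncrossing: if `{c, d'}` is not a separator, there is no vertex in the corner between
`{c, d}` and `{c', d'}` that `{c, d'}` would split off. -/
theorem joinedAvoiding_or_of_preconnected {c d c' d' v : V}
    (h : (G.induce ({c, d'} : Set V)ᶜ).Preconnected) (h1 : c' ∉ ({c, d'} : Set V))
    (h2 : c' ∉ ({c, d} : Set V)) (h3 : d ∉ ({c', d'} : Set V)) (hv : v ∉ ({c, d} : Set V))
    (hv' : v ∉ ({c', d'} : Set V)) :
    G.JoinedAvoiding {c, d} v c' ∨ G.JoinedAvoiding {c', d'} v d := by
  have hvc : v ∉ ({c, d'} : Set V) := by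
    simp only [Set.mem_insert_iff, Set.mem_singleton_iff, not_or] at hv hv' ⊢
    exact ⟨hv.1, hv'.2⟩
  obtain ⟨p, hp⟩ := preconnected_induce_compl_iff.1 h v c' hvc h1
  clear hvc h
  generalize he : c' = e at p
  -- Follow the walk until it first meets `c'` or `d`; up to that point it avoids all four vertices.
  induction p with
  | nil => subst he; simp at hv'
  | @cons v u w hvu p ih =>
    subst he
    by_cases hud : u = d
    · subst hud
      exact Or.inr (.of_adj hvu hv' h3)
    by_cases huc : u = c'
    · subst huc
      exact Or.inl (.of_adj hvu hv h2)
    have hu := hp u (by simp)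
    simp only [Set.mem_insert_iff, Set.mem_singleton_iff, not_or] at hu
    have hu1 : u ∉ ({c, d} : Set V) := by simp [hu.1, hud]
    have hu2 : u ∉ ({c', d'} : Set V) := by simp [hu.2, huc]
    rcases ih hu1 hu2 rfl (fun x hx => hp x (by simp [hx])) with h | h
    · exact Or.inl ((JoinedAvoiding.of_adj hvu hv hu1).trans h)
    · exact Or.inr ((JoinedAvoiding.of_adj hvu hv' hu2).trans h)

/-- In a block, every nontrivial bridge of a subgraph with at least two vertices has at least two
attachments. -/
theorem IsBlock.exists_attachment_ne (hG : G.IsBlock) {H : G.Subgraph} (hH : H.verts.Nontrivial)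
    (K : (G.induce H.vertsᶜ).ConnectedComponent) {x : V} (hx : x ∈ H.verts) :
    ∃ y ∈ (G.componentBridge H K).verts ∩ H.verts, y ≠ x := by
  obtain ⟨⟨t, ht⟩, rfl⟩ := K.exists_rep
  obtain ⟨h, hh, hhx⟩ := hH.exists_ne x
  -- A walk that avoids `x` and leads from the component to another vertex of `H` first enters `H`
  -- at an attachment different from `x`.
  obtain ⟨p, hp⟩ := hG.joinedAvoiding (v := x) (a := t) (b := h) (fun h' => ht (h' ▸ hx)) hhx
  obtain ⟨z, hz, hzp, q, hq⟩ := p.exists_walk_to_first_mem (T := H.verts) ht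
    fun h' => h'.right_notMem hh
  refine ⟨z, ⟨Or.inr ⟨hz, ?_⟩, hz⟩, hp z hzp⟩
  have hq' : ∀ u ∈ q.reverse.support, u = z ∨ G.JoinedAvoiding H.verts t u := by simpa using hq
  revert hq'
  generalize q.reverse = q'
  intro hq'
  cases q' with
  | nil => exact absurd hz ht
  | @cons _ u _ hzu r =>
    refine ⟨u, (mem_image_supp_iff ht).2 ((hq' u (by simp)).resolve_left hzu.ne'), hzu⟩

end SimpleGraph

/-! ### Arcs as index intervals. -/

namespace PlaneEmbedding

open SimpleGraph

variable {V : Type*} [Finite V] {G : SimpleGraph V} {M : PlaneEmbedding G}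

theorem arc_verts_subset (x y : V) : (M.arc x y).verts ⊆ M.outerVerts := by
  rintro z ⟨d, k, hd, -, rfl, -⟩
  exact ⟨_, hd.iterate k, rfl⟩

theorem mem_arc_self {x z : V} (h : z ∈ (M.arc x x).verts) : z = x := by
  obtain ⟨d, k, hd, hx, hz, hne⟩ := h
  rcases k with _ | k
  · exact hz.symm.trans hx
  · exact absurd hx (hne 0 (by omega))

theorem IsOuter.one_lt_faceLength {d : G.Dart} : 1 < M.faceLength d := by
  have h1 := M.faceLength_pos d
  by_contra h2
  have h3 : M.faceLength d = 1 := by omega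
  have h4 := M.walkVert_add_faceLength d 0
  rw [h3] at h4
  exact (M.walkVert_adj d 0).ne h4.symm

theorem IsOuter.arc_fst_snd (hG : G.IsBlock) {d : G.Dart} (hd : M.IsOuter d) :
    M.arc d.fst d.snd = G.subgraphOfAdj d.adj := by
  have h1 : M.walkVert d 1 = d.snd := M.next_fst d
  have hn := IsOuter.one_lt_faceLength (M := M) (d := d)
  have harc : M.arc d.fst d.snd = M.arc (M.walkVert d 0) (M.walkVert d 1) := by rw [h1]; rfl
  rw [harc]
  ext z w
  · refine (hd.mem_arc hG (i := 0) (j := 1) (by omega) (by omega)).trans ?_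
    simp only [subgraphOfAdj_verts, Set.mem_insert_iff, Set.mem_singleton_iff]
    constructor
    · rintro ⟨k, -, hk, rfl⟩
      interval_cases k
      exacts [Or.inl rfl, Or.inr h1]
    · rintro (rfl | rfl)
      exacts [⟨0, by omega, by omega, rfl⟩, ⟨1, by omega, by omega, h1⟩]
  · refine (hd.arc_adj hG (i := 0) (j := 1) (by omega) (by omega)).trans ?_
    rw [subgraphOfAdj_adj]
    constructor
    · rintro ⟨k, -, hk, h⟩
      obtain rfl : k = 0 := by omega
      rw [← h, ← h1]
      rfl
    · intro h
      refine ⟨0, by omega, by omega, ?_⟩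
      rw [← h, ← h1]
      rfl

section arcs

variable {d : G.Dart} {i j k m : ℕ}

theorem IsOuter.arc_le (hG : G.IsBlock) (hd : M.IsOuter d) (hik : i ≤ k) (hkm : k ≤ m)
    (hmj : m ≤ j) (hj : j < i + M.faceLength d) :
    M.arc (M.walkVert d k) (M.walkVert d m) ≤ M.arc (M.walkVert d i) (M.walkVert d j) := by
  constructor
  · intro z hz
    obtain ⟨t, h1, h2, h3⟩ := (hd.mem_arc hG hkm (by omega)).1 hz
    exact (hd.mem_arc hG (by omega) hj).2 ⟨t, by omega, by omega, h3⟩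
  · intro z w hz
    obtain ⟨t, h1, h2, h3⟩ := (hd.arc_adj hG hkm (by omega)).1 hz
    exact (hd.arc_adj hG (by omega) hj).2 ⟨t, by omega, by omega, h3⟩

theorem IsOuter.walkVert_mem_arc_iff (hG : G.IsBlock) (hd : M.IsOuter d) (hij : i ≤ j)
    (hj : j < i + M.faceLength d) (hk : i ≤ k) (hk' : k < i + M.faceLength d) :
    M.walkVert d k ∈ (M.arc (M.walkVert d i) (M.walkVert d j)).verts ↔ k ≤ j := by
  rw [hd.mem_arc hG hij hj]
  constructor
  · rintro ⟨t, h1, h2, h3⟩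
    rwa [← hd.walkVert_inj hG h3 (by omega) (by omega)]
  · exact fun h => ⟨k, hk, h, rfl⟩

theorem IsOuter.arc_lt (hG : G.IsBlock) (hd : M.IsOuter d) (hik : i ≤ k) (hkm : k ≤ m)
    (hmj : m ≤ j) (hj : j < i + M.faceLength d) (hne : i < k ∨ m < j) :
    M.arc (M.walkVert d k) (M.walkVert d m) < M.arc (M.walkVert d i) (M.walkVert d j) := by
  refine lt_of_le_not_ge (hd.arc_le hG hik hkm hmj hj) fun h => ?_
  rcases hne with h1 | h1
  · have h2 := h.1 ((hd.walkVert_mem_arc_iff hG (by omega) hj le_rfl (by omega)).2 (by omega))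
    obtain ⟨t, h3, h4, h5⟩ := (hd.mem_arc hG hkm (by omega)).1 h2
    have := hd.walkVert_inj hG h5 (by omega) (by omega)
    omega
  · have h2 := h.1 ((hd.walkVert_mem_arc_iff hG (by omega) hj (by omega) hj).2 le_rfl)
    obtain ⟨t, h3, h4, h5⟩ := (hd.mem_arc hG hkm (by omega)).1 h2
    have := hd.walkVert_inj hG h5 (by omega) (by omega)
    omega

/-- The endvertices of an arc within another arc appear in the right order. -/
theorem IsOuter.exists_of_arc_le (hG : G.IsBlock) (hd : M.IsOuter d) (hn : 3 ≤ M.faceLength d)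
    (hij : i ≤ j) (hj : j < i + M.faceLength d) {x y : V} (hxy : x ≠ y)
    (hx : x ∈ (M.arc (M.walkVert d i) (M.walkVert d j)).verts)
    (hy : y ∈ (M.arc (M.walkVert d i) (M.walkVert d j)).verts)
    (h : M.arc x y ≤ M.arc (M.walkVert d i) (M.walkVert d j)) :
    ∃ k m, i ≤ k ∧ k < m ∧ m ≤ j ∧ M.walkVert d k = x ∧ M.walkVert d m = y := by
  obtain ⟨k, hk, hkj, rfl⟩ := (hd.mem_arc hG hij hj).1 hx
  obtain ⟨m, hm, hmj, rfl⟩ := (hd.mem_arc hG hij hj).1 hy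
  rcases lt_trichotomy k m with hkm | rfl | hkm
  · exact ⟨k, m, hk, hkm, hmj, rfl, rfl⟩
  · exact absurd rfl hxy
  -- In the wrong order the path from `x` to `y` wraps around and contains the edge leaving the
  -- `j`-th vertex, which the larger arc lacks.
  · exfalso
    rw [← M.walkVert_add_faceLength d m] at h
    have h1 := h.2 ((hd.arc_adj hG (by omega) (by omega)).2 ⟨j, hkj, by omega, rfl⟩)
    obtain ⟨t, h2, h3, h4⟩ := (hd.arc_adj hG hij hj).1 h1
    have := hd.edge_inj hG hn h4 (by omega) (by omega)
    omega

/-- Coordinates of an arc that contains the edge of the outer dart `d`. -/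
theorem IsOuter.exists_of_edge_mem_arc (hG : G.IsBlock) (hd : M.IsOuter d)
    (hn : 3 ≤ M.faceLength d) {x y : V} (hx : x ∈ M.outerVerts) (hy : y ∈ M.outerVerts)
    (h : (M.arc x y).Adj d.fst d.snd) :
    ∃ k m, 1 ≤ k ∧ k ≤ M.faceLength d ∧ M.faceLength d < m ∧ m < k + M.faceLength d ∧
      M.walkVert d k = x ∧ M.walkVert d m = y := by
  -- Counting from 1 places the edge of `d` at index `M.faceLength d`, so that an arc containing it
  -- is an interval around that index.
  obtain ⟨k, h1, h2, rfl⟩ := hd.exists_walkVert_eq hx 1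
  obtain ⟨m, h3, h4, rfl⟩ := hd.exists_walkVert_eq hy k
  refine ⟨k, m, h1, by omega, ?_, h4, rfl, rfl⟩
  obtain ⟨t, h5, h6, h7⟩ := (hd.arc_adj hG h3 h4).1 h
  have h8 : s(d.fst, d.snd) = s(M.walkVert d (M.faceLength d),
      M.walkVert d (M.faceLength d + 1)) := by
    have e0 := M.walkVert_add_faceLength d 0
    have e1 := M.walkVert_add_faceLength d 1
    rw [Nat.zero_add] at e0
    rw [add_comm] at e1
    rw [e0, e1, ← M.iterate_edge]
    rfl
  by_contra! hle
  have := hd.edge_inj hG hn (h7.trans h8) (by omega) (by omega)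
  omega

/-- Inner vertices of an arc are joined to one another off its ends, so the component of one of them
carries the whole arc. This translates connection by walks into the bridge language of boundary
points. -/
theorem IsOuter.memPlusBridge (hG : G.IsBlock) (hd : M.IsOuter d) (hik : i < k) (hkj : k < j)
    (hj : j < i + M.faceLength d) {t : V}
    (ht : G.JoinedAvoiding {M.walkVert d i, M.walkVert d j} (M.walkVert d k) t) :
    M.MemPlusBridge (M.walkVert d i) (M.walkVert d j) t := by
  set H := G.vertexSubgraph {M.walkVert d i, M.walkVert d j} with hH
  have hk : M.walkVert d k ∈ H.vertsᶜ := ht.left_notMem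
  refine ⟨G.componentBridge H ((G.induce H.vertsᶜ).connectedComponentMk ⟨_, hk⟩),
    Or.inr ⟨_, rfl⟩, ?_, Or.inl ((mem_image_supp_iff hk).2 ht)⟩
  have hin : ∀ r, i < r → r < j → M.walkVert d r ∈
      Subtype.val '' ((G.induce H.vertsᶜ).connectedComponentMk ⟨_, hk⟩).supp :=
    fun r h1 h2 => (mem_image_supp_iff hk).2 (hd.joinedAvoiding_arc hG (by omega) hik hkj h1 h2)
  constructor
  · intro z hz
    obtain ⟨r, h1, h2, rfl⟩ := (hd.mem_arc hG (by omega) hj).1 hz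
    rcases h1.eq_or_lt with rfl | h1
    · exact Or.inr ⟨Or.inl rfl, _, hin (i + 1) (by omega) (by omega), M.walkVert_adj d i⟩
    · rcases h2.eq_or_lt with rfl | h2
      · refine Or.inr ⟨Or.inr rfl, _, hin (r - 1) (by omega) (by omega), ?_⟩
        have := (M.walkVert_adj d (r - 1)).symm
        rwa [Nat.sub_add_cancel (by omega)] at this
      · exact Or.inl (hin r h1 h2)
  · intro z w hz
    obtain ⟨r, h1, h2, h3⟩ := (hd.arc_adj hG (by omega) hj).1 hz
    refine ⟨(M.arc _ _).adj_sub hz, ?_⟩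
    have h4 : M.walkVert d r ∈ Subtype.val ''
          ((G.induce H.vertsᶜ).connectedComponentMk ⟨_, hk⟩).supp ∨
        M.walkVert d (r + 1) ∈ Subtype.val ''
          ((G.induce H.vertsᶜ).connectedComponentMk ⟨_, hk⟩).supp := by
      rcases h1.eq_or_lt with rfl | h1
      · exact Or.inr (hin _ (by omega) (by omega))
      · exact Or.inl (hin _ h1 h2)
    rcases Sym2.eq_iff.1 h3 with ⟨rfl, rfl⟩ | ⟨rfl, rfl⟩
    exacts [h4, h4.symm]

end arcs

/-! ### Boundary parts. -/

/-- Two boundary parts with a common edge are equal. -/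
theorem IsBoundaryPart.eq_of_adj (hG : G.IsBlock) {S : Set V} {l r : V} (hl : l ∈ S)
    (hr : r ∈ S) (hlo : l ∈ M.outerVerts) (hro : r ∈ M.outerVerts) (hlr : l ≠ r)
    {d : G.Dart} (hd : M.IsOuter d) (hn : 3 ≤ M.faceLength d) {Z Z' : G.Subgraph}
    (hZ : M.IsBoundaryPart S Z) (hZ' : M.IsBoundaryPart S Z') (h : Z.Adj d.fst d.snd)
    (h' : Z'.Adj d.fst d.snd) : Z = Z' := by
  obtain ⟨x, hx, y, hy, rfl, hin⟩ := hZ.1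
  obtain ⟨x', hx', y', hy', rfl, hin'⟩ := hZ'.1
  obtain ⟨p, q, h1, h2, h3, h4, rfl, rfl⟩ := hd.exists_of_edge_mem_arc hG hn hx hy h
  obtain ⟨p', q', h1', h2', h3', h4', rfl, rfl⟩ := hd.exists_of_edge_mem_arc hG hn hx' hy' h'
  have hS : ∀ k, min p p' < k → k < max q q' → M.walkVert d k ∉ S := by
    intro k hk hk'
    have hcase : (p < k ∧ k < q) ∨ (p' < k ∧ k < q') := by omega
    rcases hcase with ⟨ha, hb⟩ | ⟨ha, hb⟩
    · exact hin _ ((hd.walkVert_mem_arc_iff hG (by omega) h4 (by omega) (by omega)).2 (by omega))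
        (hd.walkVert_ne hG ha (by omega)).symm (hd.walkVert_ne hG hb (by omega))
    · exact hin' _ ((hd.walkVert_mem_arc_iff hG (by omega) h4' (by omega) (by omega)).2
        (by omega)) (hd.walkVert_ne hG ha (by omega)).symm (hd.walkVert_ne hG hb (by omega))
  obtain ⟨a, ha1, ha2, rfl⟩ := hd.exists_walkVert_eq hlo (min p p')
  obtain ⟨b, hb1, hb2, rfl⟩ := hd.exists_walkVert_eq hro (min p p')
  have hab : a ≠ b := fun h => hlr (by rw [h])
  have ha : ¬ (min p p' < a ∧ a < max q q') := fun h => hS a h.1 h.2 hl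
  have hb : ¬ (min p p' < b ∧ b < max q q') := fun h => hS b h.1 h.2 hr
  -- The distinct boundary points `l` and `r` are not inner vertices of the union, so the union does
  -- not close up and is again a path.
  have hlen : max q q' < min p p' + M.faceLength d := by omega
  have hP : ∃ x ∈ M.outerVerts, ∃ y ∈ M.outerVerts,
      M.arc (M.walkVert d (min p p')) (M.walkVert d (max q q')) = M.arc x y ∧
      ∀ z ∈ (M.arc (M.walkVert d (min p p')) (M.walkVert d (max q q'))).verts,
        z ≠ x → z ≠ y → z ∉ S := by
    refine ⟨_, hd.walkVert_mem _, _, hd.walkVert_mem _, rfl, fun z hz hzx hzy => ?_⟩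
    obtain ⟨k, hk1, hk2, rfl⟩ := (hd.mem_arc hG (by omega) hlen).1 hz
    refine hS k (lt_of_le_of_ne hk1 ?_) (lt_of_le_of_ne hk2 ?_)
    · rintro rfl
      exact hzx rfl
    · rintro rfl
      exact hzy rfl
  exact (hZ.eq_of_le hP (hd.arc_le hG (by omega) (by omega) (by omega) hlen)).trans
    (hZ'.eq_of_le hP (hd.arc_le hG (by omega) (by omega) (by omega) hlen)).symm

theorem IsBoundaryPoints.mem {s t : V} {a : G.Dart} {S : Set V}
    (h : M.IsBoundaryPoints s t a S) : s ∈ S ∧ a.fst ∈ S ∧ a.snd ∈ S := by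
  rcases h with ⟨-, rfl⟩ | ⟨-, -, rfl⟩ | ⟨-, w, w', -, L, -, -, rfl⟩ <;> simp

theorem IsBoundaryPart.subset_outerVerts {S : Set V} {Z : G.Subgraph}
    (h : M.IsBoundaryPart S Z) : Z.verts ⊆ M.outerVerts := by
  obtain ⟨x, -, y, -, rfl, -⟩ := h.1
  exact arc_verts_subset x y

end PlaneEmbedding

/-! ### Interlacing separators: the lemma. -/

namespace PlaneEmbedding

open SimpleGraph

variable {V : Type*} [Finite V] {G : SimpleGraph V} {M : PlaneEmbedding G}

theorem Interlace.symm {c d c' d' : V} (h : M.Interlace c d c' d') : M.Interlace c' d' c d :=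
  ⟨h.1.symm, h.2.symm⟩

theorem Interlace.ne {c d c' d' : V} (h : M.Interlace c d c' d') :
    c ≠ c' ∧ c ≠ d' ∧ d ≠ c' ∧ d ≠ d' := by
  have := h.1
  simp only [Set.disjoint_insert_left, Set.disjoint_singleton_left, Set.mem_insert_iff,
    Set.mem_singleton_iff, not_or] at this
  exact ⟨this.1.1, this.1.2, this.2.1, this.2.2⟩

/-- Positions of interlacing 2-separators in a boundary part. -/
theorem IsBoundaryPart.exists_coordinates (hG : G.IsBlock) {S : Set V} {Z : G.Subgraph}
    (hZ : M.IsBoundaryPart S Z) {c d c' d' : V} (h : M.IsSeparatorIn Z c d)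
    (h' : M.IsSeparatorIn Z c' d') (hI : M.Interlace c d c' d')
    (hc' : c' ∈ (M.arc c d).verts) :
    ∃ (e : G.Dart) (i i' j j' q : ℕ), M.IsOuter e ∧
      Z = M.arc (M.walkVert e 0) (M.walkVert e q) ∧ i < i' ∧ i' < j ∧ j < j' ∧ j' ≤ q ∧
      q < M.faceLength e ∧ M.walkVert e i = c ∧ M.walkVert e i' = c' ∧ M.walkVert e j = d ∧
      M.walkVert e j' = d' ∧ ∀ k, 0 < k → k < q → M.walkVert e k ∉ S := by
  obtain ⟨x, ⟨e, he, rfl⟩, y, hy, rfl, hin⟩ := hZ.1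
  change M.IsSeparatorIn (M.arc (M.walkVert e 0) y) c d at h
  change M.IsSeparatorIn (M.arc (M.walkVert e 0) y) c' d' at h'
  obtain ⟨q, -, hq, rfl⟩ := he.exists_walkVert_eq hy 0
  rw [Nat.zero_add] at hq
  obtain ⟨hcc, hcd, hdc, hdd⟩ := hI.ne
  have hq0 : q < 0 + M.faceLength e := by omega
  have hn : 3 ≤ M.faceLength e := by
    obtain ⟨k1, -, hk1, e1⟩ := (he.mem_arc hG (Nat.zero_le q) hq0).1 h.2.1
    obtain ⟨k2, -, hk2, e2⟩ := (he.mem_arc hG (Nat.zero_le q) hq0).1 h.2.2.1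
    obtain ⟨k3, -, hk3, e3⟩ := (he.mem_arc hG (Nat.zero_le q) hq0).1 h'.2.1
    have n1 : k1 ≠ k2 := fun hk => h.1.pair_ne (by rw [← e1, ← e2, hk])
    have n2 : k1 ≠ k3 := fun hk => hcc (by rw [← e1, ← e3, hk])
    have n3 : k2 ≠ k3 := fun hk => hdc (by rw [← e2, ← e3, hk])
    omega
  obtain ⟨i, j, -, hij, hjq, rfl, rfl⟩ :=
    he.exists_of_arc_le hG hn (Nat.zero_le q) hq0 h.1.pair_ne h.2.1 h.2.2.1 h.2.2.2
  obtain ⟨i', j', -, hij', hjq', rfl, rfl⟩ :=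
    he.exists_of_arc_le hG hn (Nat.zero_le q) hq0 h'.1.pair_ne h'.2.1 h'.2.2.1 h'.2.2.2
  have n1 : i ≠ i' := fun hk => hcc (by rw [hk])
  have n2 : j ≠ i' := fun hk => hdc (by rw [hk])
  have n3 : j ≠ j' := fun hk => hdd (by rw [hk])
  obtain ⟨k, hk1, hk2, hk3⟩ := (he.mem_arc hG hij.le (by omega)).1 hc'
  obtain rfl := he.walkVert_inj hG hk3 (by omega) (by omega)
  have hjj : j < j' := by
    rcases hI.2 with ⟨-, hI⟩ | ⟨hI, -⟩
    · rw [← M.walkVert_add_faceLength e i] at hI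
      obtain ⟨m, hm1, hm2, hm3⟩ := (he.mem_arc hG (by omega) (by omega)).1 hI
      have := he.walkVert_inj hG hm3 (by omega) (by omega)
      omega
    · obtain ⟨m, hm1, hm2, hm3⟩ := (he.mem_arc hG hij'.le (by omega)).1 hI
      have := he.walkVert_inj hG hm3 (by omega) (by omega)
      omega
  refine ⟨e, i, k, j, j', q, he, rfl, by omega, by omega, hjj, hjq', hq, rfl, rfl, rfl, rfl,
    fun m hm hmq => ?_⟩
  exact hin _ ((he.mem_arc hG (Nat.zero_le q) hq0).2 ⟨m, by omega, hmq.le, rfl⟩)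
    (he.walkVert_ne hG hm (by omega)).symm (he.walkVert_ne hG hmq (by omega))

/-- The outer ends of interlacing 2-separators, one of which is maximal, do not form a
2-separator. -/
theorem IsMaximalSeparator.not_isSeparator (hG : G.IsBlock) {S : Set V} {l r : V} (hl : l ∈ S)
    (hr : r ∈ S) (hlo : l ∈ M.outerVerts) (hro : r ∈ M.outerVerts) (hlr : l ≠ r) {e : G.Dart}
    (he : M.IsOuter e) {q : ℕ} (hq : q < M.faceLength e)
    (hZ : M.IsBoundaryPart S (M.arc (M.walkVert e 0) (M.walkVert e q))) {i j k m : ℕ}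
    (hn : 3 ≤ M.faceLength e) (hik : i ≤ k) (hkm : k < m) (hmj : m ≤ j) (hjq : j ≤ q)
    (hne : i < k ∨ m < j)
    (hmax : M.IsMaximalSeparator S (M.walkVert e k) (M.walkVert e m)) :
    ¬ G.IsSeparator 2 {M.walkVert e i, M.walkVert e j} := by
  intro hs
  -- Maximality comes with its own boundary part, which shares the first edge of the separator's
  -- path with the given part and hence equals it.
  obtain ⟨Z', hZ', h1, h2⟩ := hmax
  have hadj : (M.arc (M.walkVert e k) (M.walkVert e m)).Adj (M.next^[k] e).fst
      (M.next^[k] e).snd :=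
    (he.arc_adj hG hkm.le (by omega)).2 ⟨k, le_rfl, hkm, (M.iterate_edge e k).symm⟩
  have hlen := M.faceLength_iterate e k
  obtain rfl := hZ'.eq_of_adj hG hl hr hlo hro hlr (he.iterate k) (by omega) hZ
    (h1.2.2.2.2 hadj) ((he.arc_le hG (Nat.zero_le k) hkm.le (by omega) (by omega)).2 hadj)
  refine h2 _ _ ⟨hs, ?_, ?_, he.arc_le hG (Nat.zero_le i) (by omega) hjq (by omega)⟩
    (he.arc_lt hG hik hkm.le hmj (by omega) hne)
  · exact (he.walkVert_mem_arc_iff hG (by omega) (by omega) (by omega) (by omega)).2 (by omega)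
  · exact (he.walkVert_mem_arc_iff hG (by omega) (by omega) (by omega) (by omega)).2 (by omega)

/-- If the boundary points on the outer cycle are the ends of the path that remains after deleting
the edge `a`, and these ends do not form a 2-separator, no 2-separator as in the definition of
boundary points splits off a vertex `t` outside the outer cycle. -/
theorem not_splitsOff (hG : G.IsBlock) {s t : V} {a : G.Dart} (ha : M.IsOuter a) {S : Set V}
    (hS : M.IsBoundaryPoints s t a S) (hn : 3 ≤ M.faceLength a)
    (hSo : ∀ x ∈ S, x ∈ M.outerVerts → x = a.snd ∨ x = a.fst) (hs : s = a.snd ∨ s = a.fst)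
    (hns : ¬ G.IsSeparator 2 {a.snd, a.fst}) (ht : t ∉ M.outerVerts) {c d : V}
    (h : M.SplitsOff s t a c d) : False := by
  rcases hS with ⟨ht', -⟩ | ⟨-, hno, -⟩ | ⟨-, u, u', ⟨⟨hsep, hu, hu', -, hle⟩, -⟩, L, hL, htL, hSeq⟩
  · exact ht ht'
  · exact hno ⟨c, d, h⟩
  have hend : M.walkVert a (M.faceLength a) = a.fst := by
    have := M.walkVert_add_faceLength a 0
    rwa [Nat.zero_add] at this
  have h1 : M.walkVert a 1 = a.snd := M.next_fst a
  have hverts : u ∈ (M.arc u u').verts ∧ u' ∈ (M.arc u u').verts := by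
    obtain ⟨e, he, rfl⟩ := hu
    obtain ⟨k, -, hk, rfl⟩ := he.exists_walkVert_eq hu' 0
    exact ⟨(he.mem_arc hG (i := 0) (Nat.zero_le k) hk).2 ⟨0, le_rfl, Nat.zero_le _, rfl⟩,
      (he.mem_arc hG (i := 0) (Nat.zero_le k) hk).2 ⟨k, Nat.zero_le _, le_rfl, rfl⟩⟩
  have hpair : ∀ {x y : V}, x ≠ y → (x = a.snd ∨ x = a.fst) → (y = a.snd ∨ y = a.fst) →
      ¬ G.IsSeparator 2 {x, y} := by
    rintro x y hxy (rfl | rfl) (rfl | rfl)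
    · exact absurd rfl hxy
    · exact hns
    · rwa [Set.pair_comm]
    · exact absurd rfl hxy
  -- As `t` is off C, its bridge is not a single edge. It has two attachments, which are boundary
  -- points on C and so are both ends of `a`.
  have hatt : a.fst ∈ (M.arc u u').verts ∧ a.snd ∈ (M.arc u u').verts := by
    rcases hL with ⟨v, w, hvw, hv, hw, -, rfl⟩ | ⟨K, rfl⟩
    · rw [subgraphOfAdj_verts] at htL
      rcases htL with rfl | rfl
      exacts [absurd (arc_verts_subset _ _ hv) ht, absurd (arc_verts_subset _ _ hw) ht]
    · have hnt : (M.arc u u').verts.Nontrivial := ⟨u, hverts.1, u', hverts.2, hsep.pair_ne⟩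
      have hA : ∀ y ∈ (G.componentBridge (M.arc u u') K).verts ∩ (M.arc u u').verts,
          y = a.snd ∨ y = a.fst := fun y hy =>
        hSo y (hSeq ▸ Or.inr hy) (arc_verts_subset _ _ hy.2)
      obtain ⟨z, hz⟩ := hnt.nonempty
      obtain ⟨y, hy, -⟩ := hG.exists_attachment_ne hnt K hz
      obtain ⟨y', hy', hne⟩ := hG.exists_attachment_ne hnt K hy.2
      rcases hA y hy with rfl | rfl <;> rcases hA y' hy' with rfl | rfl
      exacts [absurd rfl hne, ⟨hy'.2, hy.2⟩, ⟨hy.2, hy'.2⟩, absurd rfl hne]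
  have hself : ∀ x, ¬ M.arc u u' ≤ M.arc x x := fun x hx =>
    hsep.pair_ne ((mem_arc_self (hx.1 hverts.1)).trans (mem_arc_self (hx.1 hverts.2)).symm)
  have hlong : ¬ M.arc u u' ≤ M.arc a.snd a.fst := by
    intro hx
    rw [← h1, ← hend] at hx
    obtain ⟨k, m, hk, hkm, hm, rfl, rfl⟩ := ha.exists_of_arc_le hG hn (by omega) (by omega)
      hsep.pair_ne (hx.1 hverts.1) (hx.1 hverts.2) hx
    have hk1 : k = 1 := by
      rw [← h1] at hatt
      obtain ⟨r, hr1, hr2, hr3⟩ := (ha.mem_arc hG hkm.le (by omega)).1 hatt.2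
      have := ha.walkVert_inj hG hr3 (by omega) (by omega)
      omega
    have hm1 : m = M.faceLength a := by
      rw [← hend] at hatt
      obtain ⟨r, hr1, hr2, hr3⟩ := (ha.mem_arc hG hkm.le (by omega)).1 hatt.1
      have := ha.walkVert_inj hG hr3 (by omega) (by omega)
      omega
    rw [hk1, hm1, h1, hend] at hsep
    exact hns hsep
  rcases hle with hle | hle | hle
  · rcases hs with rfl | rfl
    exacts [hlong hle, hself _ hle]
  · have h2 := hle.1 hverts.1
    have h3 := hle.1 hverts.2
    rw [subgraphOfAdj_verts] at h2 h3
    exact hpair hsep.pair_ne h2.symm h3.symm hsep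
  · rcases hs with rfl | rfl
    exacts [hself _ hle, hlong hle]

-- The geometric core of both claims: the non-separator formed by the outer ends forces the
-- uncovered part of C to be `a`, and then locates `s` and `t`.
theorem interlace_eq_ends (hG : G.IsBlock) {s t : V} (hs : s ∈ M.outerVerts) (hst : s ≠ t)
    {a : G.Dart} (ha : M.IsOuter a) {S : Set V} (hS : M.IsBoundaryPoints s t a S)
    {Z : G.Subgraph} {c d c' d' : V} (hZ : M.IsBoundaryPart S Z) (h : M.IsSeparatorIn Z c d)
    (h' : M.IsSeparatorIn Z c' d') (hI : M.Interlace c d c' d')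
    (hc' : c' ∈ (M.arc c d).verts)
    (hmax : M.IsMaximalSeparator S c d ∨ M.IsMaximalSeparator S c' d') :
    c = a.snd ∧ d' = a.fst ∧ Z = M.arc c d' ∧ (s = c ∧ t = d' ∨ s = d' ∧ t = c) := by
  obtain ⟨-, hl, hr⟩ := hS.mem
  have hlo : a.fst ∈ M.outerVerts := ⟨a, ha, rfl⟩
  have hro : a.snd ∈ M.outerVerts := ⟨_, ha.next, M.next_fst a⟩
  obtain ⟨e, i, i', j, j', q, he, rfl, hii, hij, hjj, hjq, hq, rfl, rfl, rfl, rfl, hin⟩ :=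
    hZ.exists_coordinates hG h h' hI hc'
  have hne : M.walkVert e i ≠ M.walkVert e j' := he.walkVert_ne hG (by omega) (by omega)
  have hns : ¬ G.IsSeparator 2 {M.walkVert e i, M.walkVert e j'} := by
    rcases hmax with hm | hm
    · exact hm.not_isSeparator hG hl hr hlo hro a.fst_ne_snd he hq hZ (by omega) (by omega)
        (by omega) (by omega) (by omega) (by omega)
    · exact hm.not_isSeparator hG hl hr hlo hro a.fst_ne_snd he hq hZ (by omega) (by omega)
        (by omega) (by omega) (by omega) (by omega)
  have hpre : (G.induce ({M.walkVert e i, M.walkVert e j'} : Set V)ᶜ).Preconnected := by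
    by_contra hcon
    exact hns ⟨by rw [Set.encard_pair hne]; rfl, hcon⟩
  have hnot : ∀ {k x y : ℕ}, k ≠ x → k ≠ y → k < x + M.faceLength e → x < k + M.faceLength e →
      k < y + M.faceLength e → y < k + M.faceLength e →
      M.walkVert e k ∉ ({M.walkVert e x, M.walkVert e y} : Set V) := by
    rintro k x y h1 h2 h3 h4 h5 h6 (h7 | h7)
    · exact h1 (he.walkVert_inj hG h7 h3 h4)
    · exact h2 (he.walkVert_inj hG h7 h5 h6)
  have huncross : ∀ v, v ∉ ({M.walkVert e i, M.walkVert e j} : Set V) →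
      v ∉ ({M.walkVert e i', M.walkVert e j'} : Set V) →
      G.JoinedAvoiding {M.walkVert e i, M.walkVert e j} v (M.walkVert e i') ∨
      G.JoinedAvoiding {M.walkVert e i', M.walkVert e j'} v (M.walkVert e j) := fun v =>
    joinedAvoiding_or_of_preconnected hpre
      (hnot (by omega) (by omega) (by omega) (by omega) (by omega) (by omega))
      (hnot (by omega) (by omega) (by omega) (by omega) (by omega) (by omega))
      (hnot (by omega) (by omega) (by omega) (by omega) (by omega) (by omega))
  -- Otherwise vertex `j' + 1` is an inner vertex of d'Cc, which either uncrossing alternative would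
  -- join to the far side of a separator.
  have hlen : i + M.faceLength e ≤ j' + 1 := by
    by_contra! hlt
    rcases huncross (M.walkVert e (j' + 1))
      (hnot (by omega) (by omega) (by omega) (by omega) (by omega) (by omega))
      (hnot (by omega) (by omega) (by omega) (by omega) (by omega) (by omega)) with hv | hv
    · exact he.not_joinedAvoiding hG hii hij (by omega) hlt h.1 hv.symm
    · exact he.not_joinedAvoiding hG hij hjj (by omega) (by omega) h'.1 hv.symm
  obtain rfl : i = 0 := by omega
  obtain rfl : j' = q := by omega
  have hend : M.walkVert e (j' + 1) = M.walkVert e 0 := by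
    have := M.walkVert_add_faceLength e 0
    rwa [show 0 + M.faceLength e = j' + 1 by omega] at this
  have hSo : ∀ x ∈ S, x ∈ M.outerVerts → x = M.walkVert e 0 ∨ x = M.walkVert e j' := by
    intro x hx hxo
    obtain ⟨k, -, hk, rfl⟩ := he.exists_walkVert_eq hxo 0
    rcases Nat.eq_zero_or_pos k with rfl | hk0
    · exact Or.inl rfl
    · by_cases hkj : k < j'
      · exact absurd hx (hin k hk0 hkj)
      · exact Or.inr (by rw [show k = j' by omega])
  obtain ⟨m, -, hm, rfl⟩ := he.exists_iterate_eq ha 0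
  -- For any other index of `a`, one of its ends would be a boundary point inside Z.
  have hm' : m = j' := by
    have hm0 : m ≠ 0 := by
      rintro rfl
      refine hin 1 (by omega) (by omega) ?_
      rw [walkVert, M.iterate_succ_fst]
      exact hr
    by_contra hne'
    exact hin m (by omega) (by omega) hl
  subst hm'
  have hfst : (M.next^[m] e).fst = M.walkVert e m := rfl
  have hsnd : (M.next^[m] e).snd = M.walkVert e 0 := by rw [← hend, walkVert, M.iterate_succ_fst]
  refine ⟨hsnd.symm, rfl, rfl, ?_⟩
  have hs' := hSo s hS.mem.1 hs
  by_cases ht : t ∈ M.outerVerts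
  · have htS : t ∈ S := by
      rcases hS with ⟨-, rfl⟩ | ⟨h1, -⟩ | ⟨h1, -⟩
      exacts [by simp, absurd ht h1, absurd ht h1]
    rcases hs' with h1 | h1 <;> rcases hSo t htS ht with h2 | h2
    exacts [absurd (h1.trans h2.symm) hst, Or.inl ⟨h1, h2⟩, Or.inr ⟨h1, h2⟩,
      absurd (h1.trans h2.symm) hst]
  · exfalso
    have hto : ∀ x y, t ∉ ({M.walkVert e x, M.walkVert e y} : Set V) := by
      rintro x y (h1 | h1)
      exacts [ht (h1 ▸ he.walkVert_mem x), ht (h1 ▸ he.walkVert_mem y)]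
    have hleZ : ∀ P, P ≤ M.arc (M.walkVert e 0) (M.walkVert e m) →
        (P ≤ M.arc s (M.next^[m] e).fst ∨ P ≤ G.subgraphOfAdj (M.next^[m] e).adj ∨
          P ≤ M.arc (M.next^[m] e).snd s) := by
      intro P hP
      rcases hs' with rfl | rfl
      · exact Or.inl hP
      · exact Or.inr (Or.inr (by rwa [hsnd]))
    have hlenm := M.faceLength_iterate e m
    have hno : ∀ c d, ¬ M.SplitsOff s t (M.next^[m] e) c d := fun c d =>
      not_splitsOff hG ha hS (by omega) (by rwa [hsnd]) (by rwa [hsnd])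
        (by rwa [hsnd]) ht
    -- Either alternative puts `t` into the bridge containing cCd or c'Cd'. Since `s` is an end of
    -- `a`, all of Z is one of the permitted paths, so that pair splits off `t`.
    rcases huncross t (hto _ _) (hto _ _) with hv | hv
    · exact hno _ _ ⟨h.1, he.walkVert_mem _, he.walkVert_mem _,
        he.memPlusBridge hG hii hij (by omega) hv.symm, hleZ _ h.2.2.2⟩
    · exact hno _ _ ⟨h'.1, he.walkVert_mem _, he.walkVert_mem _,
        he.memPlusBridge hG hij hjj (by omega) hv.symm, hleZ _ h'.2.2.2⟩

/-! ### Counting interlacing maximal separators: the corollary. -/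

/-- `{c, d}*` is a 2-separator in `Z` with inclusion-wise maximal path `cCd`. -/
def IsMaximalIn (M : PlaneEmbedding G) (Z : G.Subgraph) (c d : V) : Prop :=
  M.IsSeparatorIn Z c d ∧ ∀ c' d', M.IsSeparatorIn Z c' d' → ¬ M.arc c d < M.arc c' d'

/-- The two maximal separators may come from different boundary parts, but the edge leaving `c'`
clockwise lies on both paths, so the parts coincide and `interlace_eq_ends` applies. -/
theorem isMaximalIn_of_interlace (hG : G.IsBlock) {s t : V} (hs : s ∈ M.outerVerts)
    (hst : s ≠ t) {a : G.Dart} (ha : M.IsOuter a) {S : Set V}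
    (hS : M.IsBoundaryPoints s t a S) {c d c' d' : V} (h : M.IsMaximalSeparator S c d)
    (h' : M.IsMaximalSeparator S c' d') (hI : M.Interlace c d c' d')
    (hc' : c' ∈ (M.arc c d).verts) (hd' : d' ∈ (M.arc d c).verts) :
    c = a.snd ∧ d' = a.fst ∧ M.IsMaximalIn (M.arc a.snd a.fst) c d ∧
      M.IsMaximalIn (M.arc a.snd a.fst) c' d' := by
  have hmax := h
  obtain ⟨Z, hZ, h1, h2⟩ := h
  obtain ⟨Z', hZ', h1', h2'⟩ := h'
  obtain ⟨-, hl, hr⟩ := hS.mem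
  have hlo : a.fst ∈ M.outerVerts := ⟨a, ha, rfl⟩
  have hro : a.snd ∈ M.outerVerts := ⟨_, ha.next, M.next_fst a⟩
  have hZZ : Z = Z' := by
    obtain ⟨hcc, hcd, hdc, hdd⟩ := hI.ne
    obtain ⟨e, he, rfl⟩ := hZ.subset_outerVerts h1.2.1
    change c' ∈ (M.arc (M.walkVert e 0) d).verts at hc'
    change d' ∈ (M.arc d (M.walkVert e 0)).verts at hd'
    change M.walkVert e 0 ≠ c' at hcc
    change M.walkVert e 0 ≠ d' at hcd
    have hle := h1.2.2.2
    have hle' := h1'.2.2.2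
    obtain ⟨b, -, hb, rfl⟩ := he.exists_walkVert_eq (hZ.subset_outerVerts h1.2.2.1) 0
    obtain ⟨k, -, hk, rfl⟩ := (he.mem_arc hG (Nat.zero_le b) hb).1 hc'
    rw [← M.walkVert_add_faceLength e 0] at hd'
    obtain ⟨m, hm, hm', rfl⟩ := (he.mem_arc hG (by omega) (by
      have : b ≠ 0 := by
        rintro rfl
        exact h1.1.pair_ne rfl
      omega)).1 hd'
    have n1 : k ≠ 0 := fun h => hcc (by rw [h])
    have n2 : b ≠ k := fun h => hdc (by rw [h])
    have n3 : b ≠ m := fun h => hdd (by rw [h])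
    have n4 : m ≠ 0 + M.faceLength e := fun h =>
      hcd (by rw [h, M.walkVert_add_faceLength])
    have hlen := M.faceLength_iterate e k
    refine hZ.eq_of_adj hG hl hr hlo hro a.fst_ne_snd (he.iterate k) (by omega) hZ'
      (hle.2 ?_) (hle'.2 ?_)
    · exact (he.arc_adj hG (i := 0) (by omega) hb).2
        ⟨k, by omega, by omega, (M.iterate_edge e k).symm⟩
    · exact (he.arc_adj hG (by omega) (by omega)).2
        ⟨k, by omega, by omega, (M.iterate_edge e k).symm⟩
  subst hZZ
  obtain ⟨rfl, rfl, rfl, -⟩ := interlace_eq_ends hG hs hst ha hS hZ h1 h1' hI hc' (Or.inl hmax)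
  exact ⟨rfl, rfl, ⟨h1, h2⟩, h1', h2'⟩

/-- Subpaths with a common first vertex are nested, so two maximal ones coincide. -/
theorem IsMaximalIn.right_unique (hG : G.IsBlock) {x y d d' : V}
    (hx : x ∈ M.outerVerts) (hy : y ∈ M.outerVerts) (h : M.IsMaximalIn (M.arc x y) x d)
    (h' : M.IsMaximalIn (M.arc x y) x d') : d = d' := by
  obtain ⟨e, he, rfl⟩ := hx
  obtain ⟨q, -, hq, rfl⟩ := he.exists_walkVert_eq hy 0
  obtain ⟨j, -, hj, rfl⟩ := (he.mem_arc hG (Nat.zero_le q) hq).1 h.1.2.2.1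
  obtain ⟨j', -, hj', rfl⟩ := (he.mem_arc hG (Nat.zero_le q) hq).1 h'.1.2.2.1
  rcases lt_trichotomy j j' with hlt | rfl | hlt
  · exact absurd (he.arc_lt hG (i := 0) le_rfl (Nat.zero_le j) hlt.le (by omega) (Or.inr hlt))
      (h.2 _ _ h'.1)
  · rfl
  · exact absurd (he.arc_lt hG (i := 0) le_rfl (Nat.zero_le j') hlt.le (by omega) (Or.inr hlt))
      (h'.2 _ _ h.1)

theorem IsMaximalIn.left_unique (hG : G.IsBlock) {x y c c' : V}
    (hx : x ∈ M.outerVerts) (hy : y ∈ M.outerVerts) (h : M.IsMaximalIn (M.arc x y) c y)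
    (h' : M.IsMaximalIn (M.arc x y) c' y) : c = c' := by
  obtain ⟨e, he, rfl⟩ := hx
  obtain ⟨q, -, hq, rfl⟩ := he.exists_walkVert_eq hy 0
  obtain ⟨i, -, hi, rfl⟩ := (he.mem_arc hG (Nat.zero_le q) hq).1 h.1.2.1
  obtain ⟨i', -, hi', rfl⟩ := (he.mem_arc hG (Nat.zero_le q) hq).1 h'.1.2.1
  rcases lt_trichotomy i i' with hlt | rfl | hlt
  · exact absurd (he.arc_lt hG hlt.le hi' le_rfl (by omega) (Or.inl hlt)) (h'.2 _ _ h.1)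
  · rfl
  · exact absurd (he.arc_lt hG hlt.le hi le_rfl (by omega) (Or.inl hlt)) (h.2 _ _ h'.1)

end PlaneEmbedding

theorem mainTheorem6 {V : Type*} [Finite V] {B : SimpleGraph V} (M : PlaneEmbedding B)
    (hB : B.IsBlock) (s t : V) (hs : s ∈ M.outerVerts) (hst : s ≠ t)
    (a : B.Dart) (ha : M.IsOuter a) (S : Set V) (hS : M.IsBoundaryPoints s t a S) :
    (∀ (Z : B.Subgraph) (c d c' d' : V), M.IsBoundaryPart S Z →
      M.IsSeparatorIn Z c d → M.IsSeparatorIn Z c' d' →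
      M.Interlace c d c' d' → c' ∈ (M.arc c d).verts →
      (M.IsMaximalSeparator S c d ∨ M.IsMaximalSeparator S c' d') →
      ∃ h : B.Adj s t, M.arc d' c = B.subgraphOfAdj h ∧ B.subgraphOfAdj h = B.subgraphOfAdj a.adj) ∧
    {p : V × V | M.IsMaximalSeparator S p.1 p.2 ∧
      ∃ q : V × V, M.IsMaximalSeparator S q.1 q.2 ∧ M.Interlace p.1 p.2 q.1 q.2}.encard ≤ 2 := by
  constructor
  · intro Z c d c' d' hZ h h' hI hc' hmax
    obtain ⟨rfl, rfl, -, hst'⟩ :=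
      PlaneEmbedding.interlace_eq_ends hB hs hst ha hS hZ h h' hI hc' hmax
    rw [ha.arc_fst_snd hB]
    rcases hst' with ⟨rfl, rfl⟩ | ⟨rfl, rfl⟩
    · exact ⟨a.adj.symm, (SimpleGraph.subgraphOfAdj_symm a.adj).symm,
        SimpleGraph.subgraphOfAdj_symm a.adj⟩
    · exact ⟨a.adj, rfl, rfl⟩
  · have hlo : a.fst ∈ M.outerVerts := ⟨a, ha, rfl⟩
    have hro : a.snd ∈ M.outerVerts := ⟨_, ha.next, M.next_fst a⟩
    have hsub : {p : V × V | M.IsMaximalSeparator S p.1 p.2 ∧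
        ∃ q : V × V, M.IsMaximalSeparator S q.1 q.2 ∧ M.Interlace p.1 p.2 q.1 q.2} ⊆
        {p : V × V | p.1 = a.snd ∧ M.IsMaximalIn (M.arc a.snd a.fst) p.1 p.2} ∪
        {p : V × V | p.2 = a.fst ∧ M.IsMaximalIn (M.arc a.snd a.fst) p.1 p.2} := by
      rintro ⟨c, d⟩ ⟨h, ⟨c', d'⟩, h', hI⟩
      -- The two cyclic orders decide whether the pair starts at `a.snd` or ends at `a.fst`.
      rcases hI.2 with ⟨h1, h2⟩ | ⟨h1, h2⟩
      · have := PlaneEmbedding.isMaximalIn_of_interlace hB hs hst ha hS h h' hI h1 h2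
        exact Or.inl ⟨this.1, this.2.2.1⟩
      · have := PlaneEmbedding.isMaximalIn_of_interlace hB hs hst ha hS h' h hI.symm h1 h2
        exact Or.inr ⟨this.2.1, this.2.2.2⟩
    refine (Set.encard_le_encard hsub).trans ((Set.encard_union_le _ _).trans ?_)
    rw [← one_add_one_eq_two]
    refine add_le_add (Set.encard_le_one_iff.2 ?_) (Set.encard_le_one_iff.2 ?_)
    · rintro ⟨c, d⟩ ⟨c', d'⟩ ⟨rfl : c = _, h⟩ ⟨rfl : c' = _, h'⟩
      exact congrArg (Prod.mk _) (PlaneEmbedding.IsMaximalIn.right_unique hB hro hlo h h')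
    · rintro ⟨c, d⟩ ⟨c', d'⟩ ⟨rfl : d = _, h⟩ ⟨rfl : d' = _, h'⟩
      exact congrArg (Prod.mk · _) (PlaneEmbedding.IsMaximalIn.left_unique hB hro hlo h h')
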